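/- Let $k$ be a field and let $A$ be an associative bialgebra over $k$ with unit and counit, with coproduct $\Delta(a)=\Delta^1(a)\otimes\Delta^2(a)$ (summation understood). A tetramodule over $A$ is a $k$-vector space $M$ with a (unital) $A$-bimodule structure and a (counital) $A$-bicomodule structure $\Delta_\ell\colon M\to A\otimes_k M$, $\Delta_r\colon M\to M\otimes_k A$, such that for all $a\in A$, $m\in M$ $$\Delta_\ell(am)=\Delta(a)\Delta_\ell(m),\quad \Delta_\ell(ma)=\Delta_\ell(m)\Delta(a),\quad \Delta_r(am)=\Delta(a)\Delta_r(m),\quad \Delta_r(ma)=\Delta_r(m)\Delta(a)$$ (componentwise products). Morphisms are linear maps commuting with both actions and both coactions; this is the category $\mathrm{Tetra}(A)$. The algebra $A$ with its product and coproduct is the tautological tetramodule. For tetramodules $M,N$ let $M\boxtimes_1N$ and $M\boxtimes_2N$ be the following two tetramodule structures on $M\otimes_kN$. On $M\boxtimes_1N$: $a(m\otimes n)=(am)\otimes n$, $(m\otimes n)a=m\otimes(na)$, $\Delta_\ell(m\otimes n)=\Delta^1_\ell(m)\Delta^1_\ell(n)\otimes(\Delta^2_\ell(m)\otimes\Delta^2_\ell(n))$,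 $\Delta_r(m\otimes n)=(\Delta^1_r(m)\otimes\Delta^1_r(n))\otimes\Delta^2_r(m)\Delta^2_r(n)$. On $M\boxtimes_2N$: $a(m\otimes n)=\Delta^1(a)m\otimes\Delta^2(a)n$, $(m\otimes n)a=m\Delta^1(a)\otimes n\Delta^2(a)$, $\Delta_\ell(m\otimes n)=\Delta^1_\ell(m)\otimes(\Delta^2_\ell(m)\otimes n)$, $\Delta_r(m\otimes n)=(m\otimes\Delta_r^1(n))\otimes\Delta^2_r(n)$. Let $$M\otimes_1N=(M\boxtimes_1N)/\langle ma\otimes n-m\otimes an\rangle,\qquad M\otimes_2N=\Bigl\{\sum_i m_i\otimes n_i\in M\boxtimes_2N:\ \sum_i\Delta_r(m_i)\otimes n_i=\sum_i m_i\otimes\Delta_\ell(n_i)\Bigr\},$$ a quotient tetramodule and a subtetramodule; both are bifunctors on $\mathrm{Tetra}(A)$. **Theorem.** $\mathrm{Tetra}(A)$ is a 2-fold monoidal category in the sense of Balteanu–Fiedorowicz–Schwänzl–Vogt (in the form with associativity and unit isomorphisms instead of equalities) with products $\otimes_1,\otimes_2$ and common unit object the tautological tetramodule $A$. Explicitly: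 1. $(\otimes_1,A)$ and $(\otimes_2,A)$ are monoidal structures (natural associativity and unit isomorphisms satisfying the pentagon and triangle axioms). The associativity isomorphisms $\alpha_1,\alpha_2$ are induced by $(m\otimes n)\otimes p\mapsto m\otimes(n\otimes p)$; the unit isomorphisms $\lambda_1\colon A\otimes_1M\to M$ and $\rho_1\colon M\otimes_1A\to M$ are given by the left and right actions, and the unit isomorphisms $\lambda_2\colon A\otimes_2M\to M$ and $\rho_2\colon M\otimes_2A\to M$ are inverse to $\Delta_\ell$ and $\Delta_r$. 2. There are morphisms of tetramodules, natural in $M,N,P,Q$, $$\eta_{M,N,P,Q}\colon(M\otimes_2N)\otimes_1(P\otimes_2Q)\to(M\otimes_1P)\otimes_2(N\otimes_1Q),$$ induced by the swap of the middle factors $m\otimes n\otimes p\otimes q\mapsto m\otimes p\otimes n\otimes q$. 3. (Internal associativity) The two maps from $\bigl((U\otimes_2V)\otimes_1(W\otimes_2X)\bigr)\otimes_1(Y\otimes_2Z)$ to $\bigl(U\otimes_1(W\otimes_1Y)\bigr)\otimes_2\bigl(V\otimes_1(X\otimes_1Z)\bigr)$ obtained from $\alpha_1$ and $\eta$ coincide: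 $$(\alpha_1\otimes_2\alpha_1)\circ\eta_{U\otimes_1W,V\otimes_1X,Y,Z}\circ(\eta_{U,V,W,X}\otimes_1\mathrm{id})=\eta_{U,V,W\otimes_1Y,X\otimes_1Z}\circ(\mathrm{id}\otimes_1\eta_{W,X,Y,Z})\circ\alpha_1.$$ 4. (External associativity) As maps from $\bigl((U\otimes_2V)\otimes_2W\bigr)\otimes_1\bigl((X\otimes_2Y)\otimes_2Z\bigr)$ to $(U\otimes_1X)\otimes_2\bigl((V\otimes_1Y)\otimes_2(W\otimes_1Z)\bigr)$, $$\alpha_2\circ(\eta_{U,V,X,Y}\otimes_2\mathrm{id})\circ\eta_{U\otimes_2V,W,X\otimes_2Y,Z}=(\mathrm{id}\otimes_2\eta_{V,W,Y,Z})\circ\eta_{U,V\otimes_2W,X,Y\otimes_2Z}\circ(\alpha_2\otimes_1\alpha_2).$$ 5. (Unit conditions) Up to the unit isomorphisms, $\eta_{M,N,A,A}$ and $\eta_{A,A,M,N}$ are the identity of $M\otimes_2N$, and $\eta_{M,A,N,A}$ and $\eta_{A,M,A,N}$ are the identity of $M\otimes_1N$: $$(\rho_1\otimes_2\rho_1)\circ\eta_{M,N,A,A}=\rho_1\circ(\mathrm{id}\otimes_1\lambda_2),\qquad(\lambda_1\otimes_2\lambda_1)\circ\eta_{A,A,M,N}=\lambda_1\circ(\lambda_2\otimes_1\mathrm{id}),$$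 $$\rho_2\circ(\mathrm{id}\otimes_2\lambda_1)\circ\eta_{M,A,N,A}=\rho_2\otimes_1\rho_2,\qquad\lambda_2\circ(\lambda_1\otimes_2\mathrm{id})\circ\eta_{A,M,A,N}=\lambda_2\otimes_1\lambda_2.$$ -/

import Mathlib

universe u v

open CategoryTheory
open scoped TensorProduct CategoryTheory.Prod

noncomputable section

/-! ### Monoidal and 2-fold monoidal structures on a category -/

/-- A monoidal structure on a category `C` with prescribed unit object `I` and prescribed tensor
product bifunctor `T`: natural associativity and unit isomorphisms satisfying the pentagon and
triangle axioms. -/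
structure MonoidalStructure {C : Type u} [Category.{v} C] (I : C) (T : C × C ⥤ C) where
  /-- `(X ⊗ Y) ⊗ Z ≅ X ⊗ (Y ⊗ Z)` -/
  α : ∀ X Y Z : C, T.obj (T.obj (X, Y), Z) ≅ T.obj (X, T.obj (Y, Z))
  /-- `I ⊗ X ≅ X` -/
  lam : ∀ X : C, T.obj (I, X) ≅ X
  /-- `X ⊗ I ≅ X` -/
  rho : ∀ X : C, T.obj (X, I) ≅ X
  α_naturality : ∀ {X Y Z X' Y' Z' : C} (f : X ⟶ X') (g : Y ⟶ Y') (h : Z ⟶ Z'),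
    T.map (T.map (f ×ₘ g) ×ₘ h) ≫ (α X' Y' Z').hom =
      (α X Y Z).hom ≫ T.map (f ×ₘ T.map (g ×ₘ h))
  lam_naturality : ∀ {X Y : C} (f : X ⟶ Y),
    T.map (𝟙 I ×ₘ f) ≫ (lam Y).hom = (lam X).hom ≫ f
  rho_naturality : ∀ {X Y : C} (f : X ⟶ Y),
    T.map (f ×ₘ 𝟙 I) ≫ (rho Y).hom = (rho X).hom ≫ f
  pentagon : ∀ W X Y Z : C,
    T.map ((α W X Y).hom ×ₘ 𝟙 Z) ≫ (α W (T.obj (X, Y)) Z).hom ≫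
        T.map (𝟙 W ×ₘ (α X Y Z).hom) =
      (α (T.obj (W, X)) Y Z).hom ≫ (α W X (T.obj (Y, Z))).hom
  triangle : ∀ X Y : C,
    (α X I Y).hom ≫ T.map (𝟙 X ×ₘ (lam Y).hom) = T.map ((rho X).hom ×ₘ 𝟙 Y)

/-- A 2-fold monoidal structure on a category `C` with prescribed common unit object `I` and
prescribed tensor products `T₁`, `T₂`: two monoidal structures together with a natural (not
necessarily invertible) interchange map
`η : (U ⊗₂ V) ⊗₁ (W ⊗₂ X) ⟶ (U ⊗₁ W) ⊗₂ (V ⊗₁ X)`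
satisfying internal and external associativity and the internal and external unit conditions.
The identifications that are equalities in the strict case are the associativity and unit
isomorphisms of the two monoidal structures. -/
structure TwoFoldMonoidalStructure {C : Type u} [Category.{v} C] (I : C) (T₁ T₂ : C × C ⥤ C) where
  first : MonoidalStructure I T₁
  second : MonoidalStructure I T₂
  η : ∀ U V W X : C, T₁.obj (T₂.obj (U, V), T₂.obj (W, X)) ⟶
    T₂.obj (T₁.obj (U, W), T₁.obj (V, X))
  η_naturality : ∀ {U V W X U' V' W' X' : C}
    (f : U ⟶ U') (g : V ⟶ V') (h : W ⟶ W') (l : X ⟶ X'),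
    T₁.map (T₂.map (f ×ₘ g) ×ₘ T₂.map (h ×ₘ l)) ≫ η U' V' W' X' =
      η U V W X ≫ T₂.map (T₁.map (f ×ₘ h) ×ₘ T₁.map (g ×ₘ l))
  internal_assoc : ∀ U V W X Y Z : C,
    T₁.map (η U V W X ×ₘ 𝟙 (T₂.obj (Y, Z))) ≫
        η (T₁.obj (U, W)) (T₁.obj (V, X)) Y Z ≫
          T₂.map ((first.α U W Y).hom ×ₘ (first.α V X Z).hom) =
      (first.α (T₂.obj (U, V)) (T₂.obj (W, X)) (T₂.obj (Y, Z))).hom ≫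
        T₁.map (𝟙 (T₂.obj (U, V)) ×ₘ η W X Y Z) ≫
          η U V (T₁.obj (W, Y)) (T₁.obj (X, Z))
  external_assoc : ∀ U V W X Y Z : C,
    η (T₂.obj (U, V)) W (T₂.obj (X, Y)) Z ≫
        T₂.map (η U V X Y ×ₘ 𝟙 (T₁.obj (W, Z))) ≫
          (second.α (T₁.obj (U, X)) (T₁.obj (V, Y)) (T₁.obj (W, Z))).hom =
      T₁.map ((second.α U V W).hom ×ₘ (second.α X Y Z).hom) ≫
        η U (T₂.obj (V, W)) X (T₂.obj (Y, Z)) ≫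
          T₂.map (𝟙 (T₁.obj (U, X)) ×ₘ η V W Y Z)
  internal_unit_right : ∀ X Y : C,
    η X Y I I ≫ T₂.map ((first.rho X).hom ×ₘ (first.rho Y).hom) =
      T₁.map (𝟙 (T₂.obj (X, Y)) ×ₘ (second.lam I).hom) ≫ (first.rho (T₂.obj (X, Y))).hom
  internal_unit_left : ∀ X Y : C,
    η I I X Y ≫ T₂.map ((first.lam X).hom ×ₘ (first.lam Y).hom) =
      T₁.map ((second.lam I).hom ×ₘ 𝟙 (T₂.obj (X, Y))) ≫ (first.lam (T₂.obj (X, Y))).hom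
  external_unit_right : ∀ X Y : C,
    η X I Y I ≫ T₂.map (𝟙 (T₁.obj (X, Y)) ×ₘ (first.lam I).hom) ≫
        (second.rho (T₁.obj (X, Y))).hom =
      T₁.map ((second.rho X).hom ×ₘ (second.rho Y).hom)
  external_unit_left : ∀ X Y : C,
    η I X I Y ≫ T₂.map ((first.lam I).hom ×ₘ 𝟙 (T₁.obj (X, Y))) ≫
        (second.lam (T₁.obj (X, Y))).hom =
      T₁.map ((second.lam X).hom ×ₘ (second.lam Y).hom)

/-! ### Induction principles for tensors -/

section induction

variable {k P Q R S T U : Type*} [CommRing k] [AddCommGroup P] [AddCommGroup Q] [AddCommGroup R]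
  [AddCommGroup S] [AddCommGroup T] [AddCommGroup U] [Module k P] [Module k Q] [Module k R]
  [Module k S] [Module k T] [Module k U]

@[elab_as_elim]
theorem ind₁ {p : P ⊗[k] Q → Prop} (x : P ⊗[k] Q) (tmul : ∀ a b, p (a ⊗ₜ b))
    (add : ∀ x x', p x → p x' → p (x + x')) : p x :=
  TensorProduct.induction_on x (by simpa using tmul 0 0) tmul add

@[elab_as_elim]
theorem ind₂ {p : P ⊗[k] Q → R ⊗[k] S → Prop} (x : P ⊗[k] Q) (y : R ⊗[k] S)
    (tmul : ∀ a b c d, p (a ⊗ₜ b) (c ⊗ₜ d))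
    (addl : ∀ x x' y, p x y → p x' y → p (x + x') y)
    (addr : ∀ x y y', p x y → p x y' → p x (y + y')) : p x y := by
  induction x using ind₁ with
  | add x x' h h' => exact addl _ _ _ h h'
  | tmul a b => exact ind₁ y (tmul a b) (addr _)

@[elab_as_elim]
theorem ind₃ {p : P ⊗[k] Q → R ⊗[k] S → T ⊗[k] U → Prop} (x : P ⊗[k] Q) (y : R ⊗[k] S)
    (z : T ⊗[k] U) (tmul : ∀ a b c d e f, p (a ⊗ₜ b) (c ⊗ₜ d) (e ⊗ₜ f))
    (add₁ : ∀ x x' y z, p x y z → p x' y z → p (x + x') y z)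
    (add₂ : ∀ x y y' z, p x y z → p x y' z → p x (y + y') z)
    (add₃ : ∀ x y z z', p x y z → p x y z' → p x y (z + z')) : p x y z := by
  induction x using ind₁ with
  | add x x' h h' => exact add₁ _ _ _ _ h h'
  | tmul a b => exact ind₂ y z (tmul a b) (add₂ _) (add₃ _)

end induction

/-! ### Tetramodules -/

/-- A tetramodule over a bialgebra `A` over a field `k`: a `k`-vector space which is a (unital)
`A`-bimodule and a (counital) `A`-bicomodule, such that both coactions are compatible with both
actions. Here `TensorProduct.map₂ f g (a ⊗ m) (b ⊗ n) = f a b ⊗ g m n`. -/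
structure Tetramodule (k : Type u) (A : Type v) [Field k] [Ring A] [Bialgebra k A] where
  carrier : Type v
  [addCommGroup : AddCommGroup carrier]
  [module : Module k carrier]
  /-- the left action `a ↦ m ↦ a * m` -/
  actL : A →ₗ[k] carrier →ₗ[k] carrier
  /-- the right action `m ↦ a ↦ m * a` -/
  actR : carrier →ₗ[k] A →ₗ[k] carrier
  /-- the left coaction `Δ_ℓ` -/
  coactL : carrier →ₗ[k] A ⊗[k] carrier
  /-- the right coaction `Δ_r` -/
  coactR : carrier →ₗ[k] carrier ⊗[k] A
  one_actL : ∀ m, actL 1 m = m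
  mul_actL : ∀ a b m, actL (a * b) m = actL a (actL b m)
  actR_one : ∀ m, actR m 1 = m
  actR_mul : ∀ m a b, actR m (a * b) = actR (actR m a) b
  actR_actL : ∀ a m b, actR (actL a m) b = actL a (actR m b)
  counitL : ∀ m, TensorProduct.lid k carrier
    ((Coalgebra.counit (R := k) (A := A)).rTensor carrier (coactL m)) = m
  coassocL : ∀ m, TensorProduct.assoc k A A carrier
      ((Coalgebra.comul (R := k) (A := A)).rTensor carrier (coactL m)) =
    coactL.lTensor A (coactL m)
  counitR : ∀ m, TensorProduct.rid k carrier
    ((Coalgebra.counit (R := k) (A := A)).lTensor carrier (coactR m)) = m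
  coassocR : ∀ m, TensorProduct.assoc k carrier A A (coactR.rTensor A (coactR m)) =
    (Coalgebra.comul (R := k) (A := A)).lTensor carrier (coactR m)
  coactL_coactR : ∀ m, TensorProduct.assoc k A carrier A (coactL.rTensor A (coactR m)) =
    coactR.lTensor A (coactL m)
  coactL_actL : ∀ a m, coactL (actL a m) =
    TensorProduct.map₂ (LinearMap.mul k A) actL (Coalgebra.comul a) (coactL m)
  coactL_actR : ∀ m a, coactL (actR m a) =
    TensorProduct.map₂ (LinearMap.mul k A) actR (coactL m) (Coalgebra.comul a)
  coactR_actL : ∀ a m, coactR (actL a m) =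
    TensorProduct.map₂ actL (LinearMap.mul k A) (Coalgebra.comul a) (coactR m)
  coactR_actR : ∀ m a, coactR (actR m a) =
    TensorProduct.map₂ actR (LinearMap.mul k A) (coactR m) (Coalgebra.comul a)

namespace Tetramodule

open TensorProduct (add_tmul assoc assoc_symm_tmul assoc_tmul lid map map_tmul map₂
  map₂_apply_tmul mk_apply rid smul_tmul' sub_tmul tmul_add tmul_sub)
open LinearMap (lTensor_tmul rTensor_tmul mul_apply')
open Coalgebra (coassoc_apply coassoc_symm_apply comul counit)

variable {k : Type u} {A : Type v} [Field k] [Ring A] [Bialgebra k A]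

instance : CoeSort (Tetramodule k A) (Type v) := ⟨carrier⟩

instance (M : Tetramodule k A) : AddCommGroup M := M.addCommGroup

instance (M : Tetramodule k A) : Module k M := M.module

/-- A morphism of tetramodules: a linear map commuting with both actions and both coactions. -/
@[ext]
structure Hom (M N : Tetramodule k A) where
  lin : M →ₗ[k] N
  map_actL : ∀ a m, lin (M.actL a m) = N.actL a (lin m)
  map_actR : ∀ m a, lin (M.actR m a) = N.actR (lin m) a
  map_coactL : ∀ m, N.coactL (lin m) = lin.lTensor A (M.coactL m)
  map_coactR : ∀ m, N.coactR (lin m) = lin.rTensor A (M.coactR m)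

instance : Category.{v} (Tetramodule k A) where
  Hom := Hom
  id M :=
    { lin := LinearMap.id
      map_actL := fun _ _ => rfl
      map_actR := fun _ _ => rfl
      map_coactL := fun m => by simp
      map_coactR := fun m => by simp }
  comp f g :=
    { lin := g.lin ∘ₗ f.lin
      map_actL := fun a m => by simp [f.map_actL, g.map_actL]
      map_actR := fun m a => by simp [f.map_actR, g.map_actR]
      map_coactL := fun m => by simp [f.map_coactL, g.map_coactL, LinearMap.lTensor_comp]
      map_coactR := fun m => by simp [f.map_coactR, g.map_coactR, LinearMap.rTensor_comp] }

/-- The underlying linear map of a morphism of the category of tetramodules. -/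
def lin {M N : Tetramodule k A} (f : M ⟶ N) : M →ₗ[k] N := Hom.lin f

@[ext]
theorem hom_ext {M N : Tetramodule k A} {f g : M ⟶ N} (h : lin f = lin g) : f = g :=
  Hom.ext h

@[simp] theorem lin_id (M : Tetramodule k A) : lin (𝟙 M) = LinearMap.id := rfl

@[simp] theorem lin_comp {M N P : Tetramodule k A} (f : M ⟶ N) (g : N ⟶ P) :
    lin (f ≫ g) = lin g ∘ₗ lin f := rfl

theorem lin_actL {M N : Tetramodule k A} (f : M ⟶ N) (a : A) (m : M) :
    lin f (M.actL a m) = N.actL a (lin f m) := Hom.map_actL f a m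

theorem lin_actR {M N : Tetramodule k A} (f : M ⟶ N) (m : M) (a : A) :
    lin f (M.actR m a) = N.actR (lin f m) a := Hom.map_actR f m a

theorem lin_coactL {M N : Tetramodule k A} (f : M ⟶ N) (m : M) :
    N.coactL (lin f m) = (lin f).lTensor A (M.coactL m) := Hom.map_coactL f m

theorem lin_coactR {M N : Tetramodule k A} (f : M ⟶ N) (m : M) :
    N.coactR (lin f m) = (lin f).rTensor A (M.coactR m) := Hom.map_coactR f m

theorem map₂_mul_mul (x y : A ⊗[k] A) :
    map₂ (LinearMap.mul k A) (LinearMap.mul k A) x y = x * y := by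
  induction x, y using ind₂ with
  | addl _ _ _ h h' | addr _ _ _ h h' =>
    simp only [map_add, LinearMap.add_apply, add_mul, mul_add, h, h']
  | tmul a b c d => simp

variable (k A) in
/-- The tautological tetramodule `A`. -/
def tautological : Tetramodule k A where
  carrier := A
  actL := LinearMap.mul k A
  actR := LinearMap.mul k A
  coactL := comul
  coactR := comul
  one_actL := fun m => by simp
  mul_actL := fun a b m => by simp [mul_assoc]
  actR_one := fun m => by simp
  actR_mul := fun a b m => by simp [mul_assoc]
  actR_actL := fun a b m => by simp [mul_assoc]
  counitL := fun m => by simp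
  coassocL := fun m => by simp
  counitR := fun m => by simp
  coassocR := fun m => by simp
  coactL_coactR := fun m => by simp
  coactL_actL := fun a b => by
    simp only [mul_apply', Bialgebra.comul_mul, map₂_mul_mul]
  coactL_actR := fun a b => by
    simp only [mul_apply', Bialgebra.comul_mul, map₂_mul_mul]
  coactR_actL := fun a b => by
    simp only [mul_apply', Bialgebra.comul_mul, map₂_mul_mul]
  coactR_actR := fun a b => by
    simp only [mul_apply', Bialgebra.comul_mul, map₂_mul_mul]

/-! ### The external products -/

section external

variable (M N : Tetramodule k A)

/-- `Δ_ℓ(m ⊠₁ n) = (Δ_ℓ¹(m) * Δ_ℓ¹(n)) ⊗ (Δ_ℓ²(m) ⊠₁ Δ_ℓ²(n))`. -/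
def external₁CoactL : M ⊗[k] N →ₗ[k] A ⊗[k] (M ⊗[k] N) :=
  TensorProduct.lift ((map₂ (LinearMap.mul k A)
    (TensorProduct.mk k M N)).compl₁₂ M.coactL N.coactL)

/-- `Δ_r(m ⊠₁ n) = (Δ_r¹(m) ⊠₁ Δ_r¹(n)) ⊗ (Δ_r²(m) * Δ_r²(n))`. -/
def external₁CoactR : M ⊗[k] N →ₗ[k] (M ⊗[k] N) ⊗[k] A :=
  TensorProduct.lift ((map₂ (TensorProduct.mk k M N)
    (LinearMap.mul k A)).compl₁₂ M.coactR N.coactR)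

@[simp] theorem external₁CoactL_tmul (m : M) (n : N) : external₁CoactL M N (m ⊗ₜ n) =
    map₂ (LinearMap.mul k A) (TensorProduct.mk k M N) (M.coactL m) (N.coactL n) :=
  rfl

@[simp] theorem external₁CoactR_tmul (m : M) (n : N) : external₁CoactR M N (m ⊗ₜ n) =
    map₂ (TensorProduct.mk k M N) (LinearMap.mul k A) (M.coactR m) (N.coactR n) :=
  rfl

/-- `a * (m ⊠₁ n) = (a * m) ⊠₁ n`. -/
def external₁ActL : A →ₗ[k] M ⊗[k] N →ₗ[k] M ⊗[k] N := LinearMap.rTensorHom N ∘ₗ M.actL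

/-- `(m ⊠₁ n) * a = m ⊠₁ (n * a)`. -/
def external₁ActR : M ⊗[k] N →ₗ[k] A →ₗ[k] M ⊗[k] N :=
  (LinearMap.lTensorHom M ∘ₗ N.actR.flip).flip

@[simp] theorem external₁ActL_tmul (a : A) (m : M) (n : N) :
    external₁ActL M N a (m ⊗ₜ n) = M.actL a m ⊗ₜ n := rfl

@[simp] theorem external₁ActR_tmul (m : M) (n : N) (a : A) :
    external₁ActR M N (m ⊗ₜ n) a = m ⊗ₜ N.actR n a := rfl

theorem external₁_counitL (x : M ⊗[k] N) :
    lid k (M ⊗[k] N)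
      ((counit (R := k) (A := A)).rTensor (M ⊗[k] N) (external₁CoactL M N x)) = x := by
  induction x using ind₁ with
  | add _ _ h h' => simp only [map_add, h, h']
  | tmul m n =>
    rw [external₁CoactL_tmul]
    conv_rhs => rw [← M.counitL m, ← N.counitL n]
    generalize M.coactL m = u
    generalize N.coactL n = w
    induction u, w using ind₂ with
    | addl _ _ _ h h' | addr _ _ _ h h' =>
      simp only [map_add, LinearMap.add_apply, add_tmul, tmul_add, h, h']
    | tmul a m b n => simp [← smul_tmul', smul_smul, mul_comm]

theorem external₁_coassocL (x : M ⊗[k] N) :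
    assoc k A A (M ⊗[k] N)
      ((comul (R := k) (A := A)).rTensor (M ⊗[k] N) (external₁CoactL M N x)) =
    (external₁CoactL M N).lTensor A (external₁CoactL M N x) := by
  induction x using ind₁ with
  | add _ _ h h' => simp only [map_add, h, h']
  | tmul m n =>
    rw [external₁CoactL_tmul]
    trans map₂ (LinearMap.mul k A) (map₂ (LinearMap.mul k A)
      (TensorProduct.mk k M N)) (M.coactL.lTensor A (M.coactL m))
        (N.coactL.lTensor A (N.coactL n))
    · rw [← M.coassocL, ← N.coassocL]
      generalize M.coactL m = u
      generalize N.coactL n = w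
      induction u, w using ind₂ with
      | addl _ _ _ h h' | addr _ _ _ h h' => simp only [map_add, LinearMap.add_apply, h, h']
      | tmul a m b n =>
        simp only [map₂_apply_tmul, map_tmul,
          rTensor_tmul, mul_apply', Bialgebra.comul_mul,
          ← map₂_mul_mul]
        generalize (comul a : A ⊗[k] A) = x
        generalize (comul b : A ⊗[k] A) = y
        induction x, y using ind₂ with
        | addl _ _ _ h h' | addr _ _ _ h h' =>
          simp only [map_add, LinearMap.add_apply, add_tmul, h, h']
        | tmul a m b n => simp
    · generalize M.coactL m = u
      generalize N.coactL n = w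
      induction u, w using ind₂ with
      | addl _ _ _ h h' | addr _ _ _ h h' => simp only [map_add, LinearMap.add_apply, h, h']
      | tmul a m b n => simp

theorem external₁_counitR (x : M ⊗[k] N) :
    rid k (M ⊗[k] N)
      ((counit (R := k) (A := A)).lTensor (M ⊗[k] N) (external₁CoactR M N x)) = x := by
  induction x using ind₁ with
  | add _ _ h h' => simp only [map_add, h, h']
  | tmul m n =>
    rw [external₁CoactR_tmul]
    conv_rhs => rw [← M.counitR m, ← N.counitR n]
    generalize M.coactR m = u
    generalize N.coactR n = w
    induction u, w using ind₂ with
    | addl _ _ _ h h' | addr _ _ _ h h' =>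
      simp only [map_add, LinearMap.add_apply, add_tmul, tmul_add, h, h']
    | tmul a m b n => simp [← smul_tmul', smul_smul, mul_comm]

theorem external₁_coassocR (x : M ⊗[k] N) :
    assoc k (M ⊗[k] N) A A
      ((external₁CoactR M N).rTensor A (external₁CoactR M N x)) =
    (comul (R := k) (A := A)).lTensor (M ⊗[k] N) (external₁CoactR M N x) := by
  induction x using ind₁ with
  | add _ _ h h' => simp only [map_add, h, h']
  | tmul m n =>
    rw [external₁CoactR_tmul]
    trans map₂ (TensorProduct.mk k M N) (map₂ (LinearMap.mul k A)
      (LinearMap.mul k A)) (comul.lTensor M (M.coactR m))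
        (comul.lTensor N (N.coactR n))
    · rw [← M.coassocR, ← N.coassocR]
      generalize M.coactR m = u
      generalize N.coactR n = w
      induction u, w using ind₂ with
      | addl _ _ _ h h' | addr _ _ _ h h' => simp only [map_add, LinearMap.add_apply, h, h']
      | tmul m a n b =>
        simp only [map₂_apply_tmul, map_tmul,
          rTensor_tmul, mul_apply', mk_apply,
          external₁CoactR_tmul]
        generalize M.coactR m = x
        generalize N.coactR n = y
        induction x, y using ind₂ with
        | addl _ _ _ h h' | addr _ _ _ h h' =>
          simp only [map_add, LinearMap.add_apply, add_tmul, h, h']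
        | tmul a m b n => simp
    · generalize M.coactR m = u
      generalize N.coactR n = w
      induction u, w using ind₂ with
      | addl _ _ _ h h' | addr _ _ _ h h' => simp only [map_add, LinearMap.add_apply, h, h']
      | tmul a m b n => simp [map₂_mul_mul]

theorem external₁_coactL_coactR (x : M ⊗[k] N) :
    assoc k A (M ⊗[k] N) A
      ((external₁CoactL M N).rTensor A (external₁CoactR M N x)) =
    (external₁CoactR M N).lTensor A (external₁CoactL M N x) := by
  induction x using ind₁ with
  | add _ _ h h' => simp only [map_add, h, h']
  | tmul m n =>
    rw [external₁CoactL_tmul, external₁CoactR_tmul]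
    trans map₂ (LinearMap.mul k A) (map₂ (TensorProduct.mk k M N)
      (LinearMap.mul k A)) (M.coactR.lTensor A (M.coactL m)) (N.coactR.lTensor A (N.coactL n))
    · rw [← M.coactL_coactR, ← N.coactL_coactR]
      generalize M.coactR m = u
      generalize N.coactR n = w
      induction u, w using ind₂ with
      | addl _ _ _ h h' | addr _ _ _ h h' => simp only [map_add, LinearMap.add_apply, h, h']
      | tmul m a n b =>
        simp only [map₂_apply_tmul, map_tmul,
          rTensor_tmul, mul_apply', mk_apply,
          external₁CoactL_tmul]
        generalize M.coactL m = x
        generalize N.coactL n = y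
        induction x, y using ind₂ with
        | addl _ _ _ h h' | addr _ _ _ h h' =>
          simp only [map_add, LinearMap.add_apply, add_tmul, h, h']
        | tmul a m b n => simp
    · generalize M.coactL m = u
      generalize N.coactL n = w
      induction u, w using ind₂ with
      | addl _ _ _ h h' | addr _ _ _ h h' => simp only [map_add, LinearMap.add_apply, h, h']
      | tmul a m b n => simp

theorem external₁_coactL_actL (a : A) (x : M ⊗[k] N) :
    external₁CoactL M N (external₁ActL M N a x) =
    map₂ (LinearMap.mul k A) (external₁ActL M N) (comul a) (external₁CoactL M N x) := by
  induction x using ind₁ with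
  | add _ _ h h' => simp only [map_add, h, h']
  | tmul m n =>
    simp only [external₁ActL_tmul, external₁CoactL_tmul, M.coactL_actL]
    generalize (comul a : A ⊗[k] A) = z
    generalize M.coactL m = x
    generalize N.coactL n = y
    induction z using ind₁ with
    | add _ _ h h' => simp only [map_add, LinearMap.add_apply, h, h']
    | tmul a b =>
      induction x, y using ind₂ with
      | addl _ _ _ h h' | addr _ _ _ h h' => simp only [map_add, LinearMap.add_apply, h, h']
      | tmul a m b n => simp [mul_assoc]

theorem external₁_coactL_actR (x : M ⊗[k] N) (a : A) :
    external₁CoactL M N (external₁ActR M N x a) =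
    map₂ (LinearMap.mul k A) (external₁ActR M N) (external₁CoactL M N x) (comul a) := by
  induction x using ind₁ with
  | add _ _ h h' => simp only [map_add, LinearMap.add_apply, h, h']
  | tmul m n =>
    simp only [external₁ActR_tmul, external₁CoactL_tmul, N.coactL_actR]
    generalize (comul a : A ⊗[k] A) = z
    generalize M.coactL m = x
    generalize N.coactL n = y
    induction z using ind₁ with
    | add _ _ h h' => simp only [map_add, h, h']
    | tmul a b =>
      induction x, y using ind₂ with
      | addl _ _ _ h h' | addr _ _ _ h h' => simp only [map_add, LinearMap.add_apply, h, h']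
      | tmul a m b n => simp [mul_assoc]

theorem external₁_coactR_actL (a : A) (x : M ⊗[k] N) :
    external₁CoactR M N (external₁ActL M N a x) =
    map₂ (external₁ActL M N) (LinearMap.mul k A) (comul a) (external₁CoactR M N x) := by
  induction x using ind₁ with
  | add _ _ h h' => simp only [map_add, h, h']
  | tmul m n =>
    simp only [external₁ActL_tmul, external₁CoactR_tmul, M.coactR_actL]
    generalize (comul a : A ⊗[k] A) = z
    generalize M.coactR m = x
    generalize N.coactR n = y
    induction z using ind₁ with
    | add _ _ h h' => simp only [map_add, LinearMap.add_apply, h, h']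
    | tmul a b =>
      induction x, y using ind₂ with
      | addl _ _ _ h h' | addr _ _ _ h h' => simp only [map_add, LinearMap.add_apply, h, h']
      | tmul a m b n => simp [mul_assoc]

theorem external₁_coactR_actR (x : M ⊗[k] N) (a : A) :
    external₁CoactR M N (external₁ActR M N x a) =
    map₂ (external₁ActR M N) (LinearMap.mul k A) (external₁CoactR M N x) (comul a) := by
  induction x using ind₁ with
  | add _ _ h h' => simp only [map_add, LinearMap.add_apply, h, h']
  | tmul m n =>
    simp only [external₁ActR_tmul, external₁CoactR_tmul, N.coactR_actR]
    generalize (comul a : A ⊗[k] A) = z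
    generalize M.coactR m = x
    generalize N.coactR n = y
    induction z using ind₁ with
    | add _ _ h h' => simp only [map_add, h, h']
    | tmul a b =>
      induction x, y using ind₂ with
      | addl _ _ _ h h' | addr _ _ _ h h' => simp only [map_add, LinearMap.add_apply, h, h']
      | tmul a m b n => simp [mul_assoc]

/-- The external product `M ⊠₁ N`. -/
def external₁ : Tetramodule k A where
  carrier := M ⊗[k] N
  actL := external₁ActL M N
  actR := external₁ActR M N
  coactL := external₁CoactL M N
  coactR := external₁CoactR M N
  one_actL := fun x => by
    induction x using ind₁ with
    | add _ _ h h' => simp only [map_add, h, h']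
    | tmul m n => simp [M.one_actL]
  mul_actL := fun a b x => by
    induction x using ind₁ with
    | add _ _ h h' => simp only [map_add, h, h']
    | tmul m n => simp [M.mul_actL]
  actR_one := fun x => by
    induction x using ind₁ with
    | add _ _ h h' => simp only [map_add, LinearMap.add_apply, h, h']
    | tmul m n => simp [N.actR_one]
  actR_mul := fun x a b => by
    induction x using ind₁ with
    | add _ _ h h' => simp only [map_add, LinearMap.add_apply, h, h']
    | tmul m n => simp [N.actR_mul]
  actR_actL := fun a x b => by
    induction x using ind₁ with
    | add _ _ h h' => simp only [map_add, LinearMap.add_apply, h, h']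
    | tmul m n => simp
  counitL := external₁_counitL M N
  coassocL := external₁_coassocL M N
  counitR := external₁_counitR M N
  coassocR := external₁_coassocR M N
  coactL_coactR := external₁_coactL_coactR M N
  coactL_actL := external₁_coactL_actL M N
  coactL_actR := external₁_coactL_actR M N
  coactR_actL := external₁_coactR_actL M N
  coactR_actR := external₁_coactR_actR M N

/-- `a * (m ⊠₂ n) = (Δ¹(a) * m) ⊠₂ (Δ²(a) * n)`. -/
def external₂ActL : A →ₗ[k] M ⊗[k] N →ₗ[k] M ⊗[k] N :=
  map₂ M.actL N.actL ∘ₗ comul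

/-- `(m ⊠₂ n) * a = (m * Δ¹(a)) ⊠₂ (n * Δ²(a))`. -/
def external₂ActR : M ⊗[k] N →ₗ[k] A →ₗ[k] M ⊗[k] N :=
  (map₂ M.actR N.actR).compl₂ comul

/-- `Δ_ℓ(m ⊠₂ n) = Δ_ℓ¹(m) ⊗ (Δ_ℓ²(m) ⊠₂ n)`. -/
def external₂CoactL : M ⊗[k] N →ₗ[k] A ⊗[k] (M ⊗[k] N) :=
  (assoc k A M N).toLinearMap ∘ₗ M.coactL.rTensor N

/-- `Δ_r(m ⊠₂ n) = (m ⊠₂ Δ_r¹(n)) ⊗ Δ_r²(n)`. -/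
def external₂CoactR : M ⊗[k] N →ₗ[k] (M ⊗[k] N) ⊗[k] A :=
  (assoc k M N A).symm.toLinearMap ∘ₗ N.coactR.lTensor M

theorem external₂ActL_apply (a : A) (x : M ⊗[k] N) :
    external₂ActL M N a x = map₂ M.actL N.actL (comul a) x := rfl

theorem external₂ActR_apply (x : M ⊗[k] N) (a : A) :
    external₂ActR M N x a = map₂ M.actR N.actR x (comul a) := rfl

theorem external₂CoactL_tmul (m : M) (n : N) :
    external₂CoactL M N (m ⊗ₜ n) = assoc k A M N (M.coactL m ⊗ₜ n) := rfl

theorem external₂CoactR_tmul (m : M) (n : N) :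
    external₂CoactR M N (m ⊗ₜ n) = (assoc k M N A).symm (m ⊗ₜ N.coactR n) := rfl

theorem external₂_mul_actL (a b : A) (x : M ⊗[k] N) :
    external₂ActL M N (a * b) x = external₂ActL M N a (external₂ActL M N b x) := by
  simp only [external₂ActL_apply, Bialgebra.comul_mul]
  generalize (comul a : A ⊗[k] A) = u
  generalize (comul b : A ⊗[k] A) = w
  induction u, w, x using ind₃ with
  | add₁ _ _ _ _ h h' | add₂ _ _ _ _ h h' | add₃ _ _ _ _ h h' =>
    simp only [map_add, LinearMap.add_apply, add_mul, mul_add, h, h']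
  | tmul a a' b b' m n => simp [M.mul_actL, N.mul_actL]

theorem external₂_actR_mul (x : M ⊗[k] N) (a b : A) :
    external₂ActR M N x (a * b) = external₂ActR M N (external₂ActR M N x a) b := by
  simp only [external₂ActR_apply, Bialgebra.comul_mul]
  generalize (comul a : A ⊗[k] A) = u
  generalize (comul b : A ⊗[k] A) = w
  induction u, w, x using ind₃ with
  | add₁ _ _ _ _ h h' | add₂ _ _ _ _ h h' | add₃ _ _ _ _ h h' =>
    simp only [map_add, LinearMap.add_apply, add_mul, mul_add, h, h']
  | tmul a a' b b' m n => simp [M.actR_mul, N.actR_mul]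

theorem external₂_actR_actL (a : A) (x : M ⊗[k] N) (b : A) :
    external₂ActR M N (external₂ActL M N a x) b =
      external₂ActL M N a (external₂ActR M N x b) := by
  simp only [external₂ActR_apply, external₂ActL_apply]
  generalize (comul a : A ⊗[k] A) = u
  generalize (comul b : A ⊗[k] A) = w
  induction u, w, x using ind₃ with
  | add₁ _ _ _ _ h h' | add₂ _ _ _ _ h h' | add₃ _ _ _ _ h h' =>
    simp only [map_add, LinearMap.add_apply, h, h']
  | tmul a a' b b' m n => simp [M.actR_actL, N.actR_actL]

theorem external₂_counitL (x : M ⊗[k] N) :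
    lid k (M ⊗[k] N)
      ((counit (R := k) (A := A)).rTensor (M ⊗[k] N) (external₂CoactL M N x)) = x := by
  induction x using ind₁ with
  | add _ _ h h' => simp only [map_add, h, h']
  | tmul m n =>
    rw [external₂CoactL_tmul]
    conv_rhs => rw [← M.counitL m]
    generalize M.coactL m = u
    induction u using ind₁ with
    | add _ _ h h' => simp only [map_add, add_tmul, h, h']
    | tmul a m => simp [smul_tmul']

theorem external₂_counitR (x : M ⊗[k] N) :
    rid k (M ⊗[k] N)
      ((counit (R := k) (A := A)).lTensor (M ⊗[k] N) (external₂CoactR M N x)) = x := by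
  induction x using ind₁ with
  | add _ _ h h' => simp only [map_add, h, h']
  | tmul m n =>
    rw [external₂CoactR_tmul]
    conv_rhs => rw [← N.counitR n]
    generalize N.coactR n = u
    induction u using ind₁ with
    | add _ _ h h' => simp only [map_add, tmul_add, h, h']
    | tmul n a => simp

theorem external₂_coassocL (x : M ⊗[k] N) :
    assoc k A A (M ⊗[k] N)
      ((comul (R := k) (A := A)).rTensor (M ⊗[k] N) (external₂CoactL M N x)) =
    (external₂CoactL M N).lTensor A (external₂CoactL M N x) := by
  induction x using ind₁ with
  | add _ _ h h' => simp only [map_add, h, h']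
  | tmul m n =>
    rw [external₂CoactL_tmul]
    trans (assoc k A M N).toLinearMap.lTensor A
      (assoc k A (A ⊗[k] M) N (M.coactL.lTensor A (M.coactL m) ⊗ₜ n))
    · rw [← M.coassocL]
      generalize M.coactL m = u
      induction u using ind₁ with
      | add _ _ h h' => simp only [map_add, add_tmul, h, h']
      | tmul a m =>
        simp only [assoc_tmul, rTensor_tmul]
        generalize (comul a : A ⊗[k] A) = z
        induction z using ind₁ with
        | add _ _ h h' => simp only [map_add, add_tmul, h, h']
        | tmul a b => simp
    · generalize M.coactL m = u
      induction u using ind₁ with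
      | add _ _ h h' => simp only [map_add, add_tmul, h, h']
      | tmul a m => simp [external₂CoactL_tmul]

theorem external₂_coassocR (x : M ⊗[k] N) :
    assoc k (M ⊗[k] N) A A
      ((external₂CoactR M N).rTensor A (external₂CoactR M N x)) =
    (comul (R := k) (A := A)).lTensor (M ⊗[k] N) (external₂CoactR M N x) := by
  induction x using ind₁ with
  | add _ _ h h' => simp only [map_add, h, h']
  | tmul m n =>
    rw [external₂CoactR_tmul]
    trans (assoc k M N (A ⊗[k] A)).symm
      (m ⊗ₜ assoc k N A A (N.coactR.rTensor A (N.coactR n)))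
    · generalize N.coactR n = u
      induction u using ind₁ with
      | add _ _ h h' => simp only [map_add, tmul_add, h, h']
      | tmul n a =>
        simp only [assoc_symm_tmul, rTensor_tmul, external₂CoactR_tmul]
        generalize N.coactR n = z
        induction z using ind₁ with
        | add _ _ h h' => simp only [map_add, add_tmul, tmul_add, h, h']
        | tmul n b => simp
    · rw [N.coassocR]
      generalize N.coactR n = u
      induction u using ind₁ with
      | add _ _ h h' => simp only [map_add, tmul_add, h, h']
      | tmul n a => simp

theorem external₂_coactL_coactR (x : M ⊗[k] N) :
    assoc k A (M ⊗[k] N) A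
      ((external₂CoactL M N).rTensor A (external₂CoactR M N x)) =
    (external₂CoactR M N).lTensor A (external₂CoactL M N x) := by
  induction x using ind₁ with
  | add _ _ h h' => simp only [map_add, h, h']
  | tmul m n =>
    have h₁ : ∀ w : N ⊗[k] A, (external₂CoactL M N).rTensor A
        ((assoc k M N A).symm (m ⊗ₜ w)) =
        ((assoc k A M N).toLinearMap ∘ₗ
          TensorProduct.mk k _ _ (M.coactL m)).rTensor A w := fun w => by
      induction w using ind₁ with
      | add _ _ h h' => simp only [map_add, tmul_add, h, h']
      | tmul n a => simp [external₂CoactL_tmul]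
    have h₂ : ∀ u : A ⊗[k] M, (external₂CoactR M N).lTensor A
        (assoc k A M N (u ⊗ₜ n)) =
        (assoc k M N A).symm.toLinearMap.lTensor A
          (assoc k A M (N ⊗[k] A) (u ⊗ₜ N.coactR n)) := fun u => by
      induction u using ind₁ with
      | add _ _ h h' => simp only [map_add, add_tmul, h, h']
      | tmul a m => simp [external₂CoactR_tmul]
    rw [external₂CoactL_tmul, external₂CoactR_tmul, h₁, h₂]
    generalize M.coactL m = u
    generalize N.coactR n = w
    induction w, u using ind₂ with
    | addl _ _ _ h h' | addr _ _ _ h h' =>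
      simp only [map_add, tmul_add, LinearMap.comp_add, LinearMap.rTensor_add,
        LinearMap.add_apply, add_tmul, h, h']
    | tmul n a b m => simp

theorem external₂_coactL_actL (a : A) (x : M ⊗[k] N) :
    external₂CoactL M N (external₂ActL M N a x) =
    map₂ (LinearMap.mul k A) (external₂ActL M N) (comul a)
      (external₂CoactL M N x) := by
  have h : ∀ (z : A ⊗[k] A) (y : A ⊗[k] (M ⊗[k] N)),
      map₂ (LinearMap.mul k A) (external₂ActL M N) z y =
      map₂ (LinearMap.mul k A) (map₂ M.actL N.actL)
        (comul.lTensor A z) y := fun z y => by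
    induction z using ind₁ with
    | add _ _ h h' => simp only [map_add, LinearMap.add_apply, h, h']
    | tmul a b => rfl
  rw [h, ← coassoc_apply, external₂ActL_apply]
  induction x using ind₁ with
  | add _ _ h h' => simp only [map_add, h, h']
  | tmul m n =>
    rw [external₂CoactL_tmul]
    generalize (comul a : A ⊗[k] A) = z
    induction z using ind₁ with
    | add _ _ h h' => simp only [map_add, LinearMap.add_apply, h, h']
    | tmul b c =>
      simp only [map₂_apply_tmul, map_tmul, external₂CoactL_tmul,
        M.coactL_actL, rTensor_tmul]
      generalize (comul b : A ⊗[k] A) = z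
      generalize M.coactL m = u
      induction z, u using ind₂ with
      | addl _ _ _ h h' | addr _ _ _ h h' =>
        simp only [map_add, LinearMap.add_apply, add_tmul, h, h']
      | tmul b b' d m => simp

theorem external₂_coactL_actR (x : M ⊗[k] N) (a : A) :
    external₂CoactL M N (external₂ActR M N x a) =
    map₂ (LinearMap.mul k A) (external₂ActR M N) (external₂CoactL M N x)
      (comul a) := by
  have h : ∀ (z : A ⊗[k] A) (y : A ⊗[k] (M ⊗[k] N)),
      map₂ (LinearMap.mul k A) (external₂ActR M N) y z =
      map₂ (LinearMap.mul k A) (map₂ M.actR N.actR) y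
        (comul.lTensor A z) := fun z y => by
    induction z, y using ind₂ with
    | addl _ _ _ h h' | addr _ _ _ h h' => simp only [map_add, LinearMap.add_apply, h, h']
    | tmul a b c x => rfl
  rw [h, ← coassoc_apply, external₂ActR_apply]
  induction x using ind₁ with
  | add _ _ h h' => simp only [map_add, LinearMap.add_apply, h, h']
  | tmul m n =>
    rw [external₂CoactL_tmul]
    generalize (comul a : A ⊗[k] A) = z
    induction z using ind₁ with
    | add _ _ h h' => simp only [map_add, h, h']
    | tmul b c =>
      simp only [map₂_apply_tmul, map_tmul, external₂CoactL_tmul,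
        M.coactL_actR, rTensor_tmul]
      generalize (comul b : A ⊗[k] A) = z
      generalize M.coactL m = u
      induction z, u using ind₂ with
      | addl _ _ _ h h' | addr _ _ _ h h' =>
        simp only [map_add, add_tmul, LinearMap.add_apply, h, h']
      | tmul b b' d m => simp

theorem external₂_coactR_actL (a : A) (x : M ⊗[k] N) :
    external₂CoactR M N (external₂ActL M N a x) =
    map₂ (external₂ActL M N) (LinearMap.mul k A) (comul a)
      (external₂CoactR M N x) := by
  have h : ∀ (z : A ⊗[k] A) (y : (M ⊗[k] N) ⊗[k] A),
      map₂ (external₂ActL M N) (LinearMap.mul k A) z y =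
      map₂ (map₂ M.actL N.actL) (LinearMap.mul k A)
        (comul.rTensor A z) y := fun z y => by
    induction z using ind₁ with
    | add _ _ h h' => simp only [map_add, LinearMap.add_apply, h, h']
    | tmul a b => rfl
  rw [h, ← coassoc_symm_apply, external₂ActL_apply]
  induction x using ind₁ with
  | add _ _ h h' => simp only [map_add, h, h']
  | tmul m n =>
    rw [external₂CoactR_tmul]
    generalize (comul a : A ⊗[k] A) = z
    induction z using ind₁ with
    | add _ _ h h' => simp only [map_add, LinearMap.add_apply, h, h']
    | tmul c b =>
      simp only [map₂_apply_tmul, map_tmul, external₂CoactR_tmul,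
        N.coactR_actL, lTensor_tmul]
      generalize (comul b : A ⊗[k] A) = z
      generalize N.coactR n = u
      induction z, u using ind₂ with
      | addl _ _ _ h h' | addr _ _ _ h h' =>
        simp only [map_add, LinearMap.add_apply, tmul_add, h, h']
      | tmul b b' n d => simp

theorem external₂_coactR_actR (x : M ⊗[k] N) (a : A) :
    external₂CoactR M N (external₂ActR M N x a) =
    map₂ (external₂ActR M N) (LinearMap.mul k A) (external₂CoactR M N x)
      (comul a) := by
  have h : ∀ (z : A ⊗[k] A) (y : (M ⊗[k] N) ⊗[k] A),
      map₂ (external₂ActR M N) (LinearMap.mul k A) y z =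
      map₂ (map₂ M.actR N.actR) (LinearMap.mul k A) y
        (comul.rTensor A z) := fun z y => by
    induction z, y using ind₂ with
    | addl _ _ _ h h' | addr _ _ _ h h' => simp only [map_add, LinearMap.add_apply, h, h']
    | tmul a b c x => rfl
  rw [h, ← coassoc_symm_apply, external₂ActR_apply]
  induction x using ind₁ with
  | add _ _ h h' => simp only [map_add, LinearMap.add_apply, h, h']
  | tmul m n =>
    rw [external₂CoactR_tmul]
    generalize (comul a : A ⊗[k] A) = z
    induction z using ind₁ with
    | add _ _ h h' => simp only [map_add, h, h']
    | tmul c b =>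
      simp only [map₂_apply_tmul, map_tmul, external₂CoactR_tmul,
        N.coactR_actR, lTensor_tmul]
      generalize (comul b : A ⊗[k] A) = z
      generalize N.coactR n = u
      induction z, u using ind₂ with
      | addl _ _ _ h h' | addr _ _ _ h h' =>
        simp only [map_add, tmul_add, LinearMap.add_apply, h, h']
      | tmul b b' n d => simp

/-- The external product `M ⊠₂ N`. -/
def external₂ : Tetramodule k A where
  carrier := M ⊗[k] N
  actL := external₂ActL M N
  actR := external₂ActR M N
  coactL := external₂CoactL M N
  coactR := external₂CoactR M N
  one_actL := fun x => by
    rw [external₂ActL_apply, Bialgebra.comul_one, Algebra.TensorProduct.one_def]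
    induction x using ind₁ with
    | add _ _ h h' => simp only [map_add, h, h']
    | tmul m n => simp [M.one_actL, N.one_actL]
  actR_one := fun x => by
    rw [external₂ActR_apply, Bialgebra.comul_one, Algebra.TensorProduct.one_def]
    induction x using ind₁ with
    | add _ _ h h' => simp only [map_add, LinearMap.add_apply, h, h']
    | tmul m n => simp [M.actR_one, N.actR_one]
  mul_actL := external₂_mul_actL M N
  actR_mul := external₂_actR_mul M N
  actR_actL := external₂_actR_actL M N
  counitL := external₂_counitL M N
  coassocL := external₂_coassocL M N
  counitR := external₂_counitR M N
  coassocR := external₂_coassocR M N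
  coactL_coactR := external₂_coactL_coactR M N
  coactL_actL := external₂_coactL_actL M N
  coactL_actR := external₂_coactL_actR M N
  coactR_actL := external₂_coactR_actL M N
  coactR_actR := external₂_coactR_actR M N

end external

/-! ### Subtetramodules and quotient tetramodules -/

section naturality

variable {X Y : Type v} [AddCommGroup X] [Module k X] [AddCommGroup Y] [Module k Y]
  (f : X →ₗ[k] Y)

theorem nat_counitL (u : A ⊗[k] X) : lid k Y
    ((counit (R := k) (A := A)).rTensor Y (f.lTensor A u)) =
    f (lid k X ((counit (R := k) (A := A)).rTensor X u)) := by
  induction u using ind₁ with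
  | add _ _ h h' => simp only [map_add, h, h']
  | tmul a x => simp

theorem nat_counitR (u : X ⊗[k] A) : rid k Y
    ((counit (R := k) (A := A)).lTensor Y (f.rTensor A u)) =
    f (rid k X ((counit (R := k) (A := A)).lTensor X u)) := by
  induction u using ind₁ with
  | add _ _ h h' => simp only [map_add, h, h']
  | tmul x a => simp

theorem nat_coassocL (u : A ⊗[k] X) : assoc k A A Y
    ((comul (R := k) (A := A)).rTensor Y (f.lTensor A u)) =
    (f.lTensor A).lTensor A (assoc k A A X
      ((comul (R := k) (A := A)).rTensor X u)) := by
  induction u using ind₁ with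
  | add _ _ h h' => simp only [map_add, h, h']
  | tmul a x =>
    simp only [lTensor_tmul, rTensor_tmul]
    generalize (comul a : A ⊗[k] A) = z
    induction z using ind₁ with
    | add _ _ h h' => simp only [map_add, add_tmul, h, h']
    | tmul a b => simp

theorem nat_coassocR (u : X ⊗[k] A) :
    (comul (R := k) (A := A)).lTensor Y (f.rTensor A u) =
    f.rTensor (A ⊗[k] A) ((comul (R := k) (A := A)).lTensor X u) := by
  induction u using ind₁ with
  | add _ _ h h' => simp only [map_add, h, h']
  | tmul x a => simp

theorem nat_coactLL {cX : X →ₗ[k] A ⊗[k] X} {cY : Y →ₗ[k] A ⊗[k] Y}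
    (h : ∀ x, cY (f x) = f.lTensor A (cX x)) (u : A ⊗[k] X) :
    cY.lTensor A (f.lTensor A u) = (f.lTensor A).lTensor A (cX.lTensor A u) := by
  induction u using ind₁ with
  | add _ _ h h' => simp only [map_add, h, h']
  | tmul a x => simp [h]

theorem nat_coactRR {cX : X →ₗ[k] X ⊗[k] A} {cY : Y →ₗ[k] Y ⊗[k] A}
    (h : ∀ x, cY (f x) = f.rTensor A (cX x)) (u : X ⊗[k] A) :
    assoc k Y A A (cY.rTensor A (f.rTensor A u)) =
    f.rTensor (A ⊗[k] A) (assoc k X A A (cX.rTensor A u)) := by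
  induction u using ind₁ with
  | add _ _ h h' => simp only [map_add, h, h']
  | tmul x a =>
    simp only [rTensor_tmul, h]
    generalize cX x = z
    induction z using ind₁ with
    | add _ _ h h' => simp only [map_add, add_tmul, h, h']
    | tmul a b => simp

theorem nat_coactLR {cX : X →ₗ[k] X ⊗[k] A} {cY : Y →ₗ[k] Y ⊗[k] A}
    (h : ∀ x, cY (f x) = f.rTensor A (cX x)) (u : A ⊗[k] X) :
    cY.lTensor A (f.lTensor A u) = (f.rTensor A).lTensor A (cX.lTensor A u) := by
  induction u using ind₁ with
  | add _ _ h h' => simp only [map_add, h, h']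
  | tmul a x => simp [h]

theorem nat_coactRL {cX : X →ₗ[k] A ⊗[k] X} {cY : Y →ₗ[k] A ⊗[k] Y}
    (h : ∀ x, cY (f x) = f.lTensor A (cX x)) (u : X ⊗[k] A) :
    assoc k A Y A (cY.rTensor A (f.rTensor A u)) =
    (f.rTensor A).lTensor A (assoc k A X A (cX.rTensor A u)) := by
  induction u using ind₁ with
  | add _ _ h h' => simp only [map_add, h, h']
  | tmul x a =>
    simp only [rTensor_tmul, h]
    generalize cX x = z
    induction z using ind₁ with
    | add _ _ h h' => simp only [map_add, add_tmul, h, h']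
    | tmul a b => simp

theorem nat_actLL {aX : A →ₗ[k] X →ₗ[k] X} {aY : A →ₗ[k] Y →ₗ[k] Y}
    (h : ∀ a x, aY a (f x) = f (aX a x)) (z : A ⊗[k] A) (u : A ⊗[k] X) :
    map₂ (LinearMap.mul k A) aY z (f.lTensor A u) =
    f.lTensor A (map₂ (LinearMap.mul k A) aX z u) := by
  induction z, u using ind₂ with
  | addl _ _ _ h h' | addr _ _ _ h h' => simp only [map_add, LinearMap.add_apply, h, h']
  | tmul a b c x => simp [h]

theorem nat_actLR {aX : X →ₗ[k] A →ₗ[k] X} {aY : Y →ₗ[k] A →ₗ[k] Y}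
    (h : ∀ x a, aY (f x) a = f (aX x a)) (u : A ⊗[k] X) (z : A ⊗[k] A) :
    map₂ (LinearMap.mul k A) aY (f.lTensor A u) z =
    f.lTensor A (map₂ (LinearMap.mul k A) aX u z) := by
  induction z, u using ind₂ with
  | addl _ _ _ h h' | addr _ _ _ h h' => simp only [map_add, LinearMap.add_apply, h, h']
  | tmul a b c x => simp [h]

theorem nat_actRL {aX : A →ₗ[k] X →ₗ[k] X} {aY : A →ₗ[k] Y →ₗ[k] Y}
    (h : ∀ a x, aY a (f x) = f (aX a x)) (z : A ⊗[k] A) (u : X ⊗[k] A) :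
    map₂ aY (LinearMap.mul k A) z (f.rTensor A u) =
    f.rTensor A (map₂ aX (LinearMap.mul k A) z u) := by
  induction z, u using ind₂ with
  | addl _ _ _ h h' | addr _ _ _ h h' => simp only [map_add, LinearMap.add_apply, h, h']
  | tmul a b x c => simp [h]

theorem nat_actRR {aX : X →ₗ[k] A →ₗ[k] X} {aY : Y →ₗ[k] A →ₗ[k] Y}
    (h : ∀ x a, aY (f x) a = f (aX x a)) (u : X ⊗[k] A) (z : A ⊗[k] A) :
    map₂ aY (LinearMap.mul k A) (f.rTensor A u) z =
    f.rTensor A (map₂ aX (LinearMap.mul k A) u z) := by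
  induction z, u using ind₂ with
  | addl _ _ _ h h' | addr _ _ _ h h' => simp only [map_add, LinearMap.add_apply, h, h']
  | tmul a b x c => simp [h]

end naturality

/-- A subspace `K` of a tetramodule `X` is a subtetramodule if it is stable under both actions and
`Δ_ℓ(K) ⊆ A ⊗ K`, `Δ_r(K) ⊆ K ⊗ A`. -/
structure IsSubtetramodule (X : Tetramodule k A) (K : Submodule k X) : Prop where
  actL_mem : ∀ a, ∀ x ∈ K, X.actL a x ∈ K
  actR_mem : ∀ x ∈ K, ∀ a, X.actR x a ∈ K
  coactL_mem : ∀ x ∈ K, X.coactL x ∈ LinearMap.range (K.subtype.lTensor A)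
  coactR_mem : ∀ x ∈ K, X.coactR x ∈ LinearMap.range (K.subtype.rTensor A)

section quotient

variable (X : Tetramodule k A) (K : Submodule k X) (hK : IsSubtetramodule X K)

/-- The quotient of a tetramodule by a subtetramodule. -/
def quotient : Tetramodule k A where
  carrier := X ⧸ K
  actL := (K.liftQ (X.actL.compr₂ K.mkQ).flip fun x hx => by
    ext a; simpa using hK.actL_mem a x hx).flip
  actR := K.liftQ (X.actR.compr₂ K.mkQ) fun x hx => by
    ext a; simpa using hK.actR_mem x hx a
  coactL := K.liftQ (K.mkQ.lTensor A ∘ₗ X.coactL) fun x hx => by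
    obtain ⟨y, hy⟩ := hK.coactL_mem x hx
    rw [LinearMap.mem_ker, LinearMap.comp_apply, ← hy, ← LinearMap.comp_apply,
      ← LinearMap.lTensor_comp]
    have : K.mkQ ∘ₗ K.subtype = 0 := by ext x; simp
    simp [this]
  coactR := K.liftQ (K.mkQ.rTensor A ∘ₗ X.coactR) fun x hx => by
    obtain ⟨y, hy⟩ := hK.coactR_mem x hx
    rw [LinearMap.mem_ker, LinearMap.comp_apply, ← hy, ← LinearMap.comp_apply,
      ← LinearMap.rTensor_comp]
    have : K.mkQ ∘ₗ K.subtype = 0 := by ext x; simp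
    simp [this]
  one_actL := fun m => by
    obtain ⟨x, rfl⟩ := K.mkQ_surjective m
    exact congrArg K.mkQ (X.one_actL x)
  mul_actL := fun a b m => by
    obtain ⟨x, rfl⟩ := K.mkQ_surjective m
    exact congrArg K.mkQ (X.mul_actL a b x)
  actR_one := fun m => by
    obtain ⟨x, rfl⟩ := K.mkQ_surjective m
    exact congrArg K.mkQ (X.actR_one x)
  actR_mul := fun m a b => by
    obtain ⟨x, rfl⟩ := K.mkQ_surjective m
    exact congrArg K.mkQ (X.actR_mul x a b)
  actR_actL := fun a m b => by
    obtain ⟨x, rfl⟩ := K.mkQ_surjective m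
    exact congrArg K.mkQ (X.actR_actL a x b)
  counitL := fun m => by
    obtain ⟨x, rfl⟩ := K.mkQ_surjective m
    exact (nat_counitL K.mkQ _).trans (congrArg K.mkQ (X.counitL x))
  coassocL := fun m => by
    obtain ⟨x, rfl⟩ := K.mkQ_surjective m
    refine (nat_coassocL K.mkQ _).trans ?_
    rw [X.coassocL]
    exact (nat_coactLL K.mkQ (fun _ => rfl) _).symm
  counitR := fun m => by
    obtain ⟨x, rfl⟩ := K.mkQ_surjective m
    exact (nat_counitR K.mkQ _).trans (congrArg K.mkQ (X.counitR x))
  coassocR := fun m => by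
    obtain ⟨x, rfl⟩ := K.mkQ_surjective m
    refine (nat_coactRR K.mkQ (cX := X.coactR) (fun _ => rfl) _).trans ?_
    rw [X.coassocR]
    exact (nat_coassocR K.mkQ _).symm
  coactL_coactR := fun m => by
    obtain ⟨x, rfl⟩ := K.mkQ_surjective m
    refine (nat_coactRL K.mkQ (cX := X.coactL) (fun _ => rfl) _).trans ?_
    rw [X.coactL_coactR]
    exact (nat_coactLR K.mkQ (fun _ => rfl) _).symm
  coactL_actL := fun a m => by
    obtain ⟨x, rfl⟩ := K.mkQ_surjective m
    exact (congrArg (K.mkQ.lTensor A) (X.coactL_actL a x)).trans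
      (nat_actLL K.mkQ (fun _ _ => rfl) _ _).symm
  coactL_actR := fun m a => by
    obtain ⟨x, rfl⟩ := K.mkQ_surjective m
    exact (congrArg (K.mkQ.lTensor A) (X.coactL_actR x a)).trans
      (nat_actLR K.mkQ (fun _ _ => rfl) _ _).symm
  coactR_actL := fun a m => by
    obtain ⟨x, rfl⟩ := K.mkQ_surjective m
    exact (congrArg (K.mkQ.rTensor A) (X.coactR_actL a x)).trans
      (nat_actRL K.mkQ (fun _ _ => rfl) _ _).symm
  coactR_actR := fun m a => by
    obtain ⟨x, rfl⟩ := K.mkQ_surjective m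
    exact (congrArg (K.mkQ.rTensor A) (X.coactR_actR x a)).trans
      (nat_actRR K.mkQ (fun _ _ => rfl) _ _).symm

/-- The projection onto a quotient tetramodule. -/
def quotientProj : X ⟶ X.quotient K hK :=
  Hom.mk (N := X.quotient K hK) K.mkQ (fun _ _ => rfl) (fun _ _ => rfl) (fun _ => rfl)
    (fun _ => rfl)

theorem injL (W : Submodule k X) : Function.Injective (W.subtype.lTensor A) :=
  Module.Flat.lTensor_preserves_injective_linearMap _ W.injective_subtype

theorem injR (W : Submodule k X) : Function.Injective (W.subtype.rTensor A) :=
  Module.Flat.rTensor_preserves_injective_linearMap _ W.injective_subtype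

/-- The restriction of `Δ_ℓ` to a subtetramodule. -/
def subCoactL : K →ₗ[k] A ⊗[k] K :=
  LinearMap.codRestrictOfInjective (X.coactL ∘ₗ K.subtype) (K.subtype.lTensor A) (X.injL K)
    fun x => hK.coactL_mem x x.2

/-- The restriction of `Δ_r` to a subtetramodule. -/
def subCoactR : K →ₗ[k] K ⊗[k] A :=
  LinearMap.codRestrictOfInjective (X.coactR ∘ₗ K.subtype) (K.subtype.rTensor A) (X.injR K)
    fun x => hK.coactR_mem x x.2

theorem subCoactL_spec (x : K) :
    K.subtype.lTensor A (X.subCoactL K hK x) = X.coactL (K.subtype x) :=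
  LinearMap.codRestrictOfInjective_comp_apply _ _ _ _ x

theorem subCoactR_spec (x : K) :
    K.subtype.rTensor A (X.subCoactR K hK x) = X.coactR (K.subtype x) :=
  LinearMap.codRestrictOfInjective_comp_apply _ _ _ _ x

/-- The restriction of the left action to a subtetramodule. -/
def subActL : A →ₗ[k] K →ₗ[k] K :=
  LinearMap.mk₂ k (fun a x => ⟨X.actL a x, hK.actL_mem a x x.2⟩)
    (fun a b x => by ext; simp) (fun c a x => by ext; simp)
    (fun a x y => by ext; simp) (fun c a x => by ext; simp)

/-- The restriction of the right action to a subtetramodule. -/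
def subActR : K →ₗ[k] A →ₗ[k] K :=
  LinearMap.mk₂ k (fun x a => ⟨X.actR x a, hK.actR_mem x x.2 a⟩)
    (fun a b x => by ext; simp) (fun c a x => by ext; simp)
    (fun a x y => by ext; simp) (fun c a x => by ext; simp)

/-- A subtetramodule as a tetramodule. -/
def sub : Tetramodule k A where
  carrier := K
  actL := X.subActL K hK
  actR := X.subActR K hK
  coactL := X.subCoactL K hK
  coactR := X.subCoactR K hK
  one_actL := fun x => Subtype.ext (X.one_actL x)
  mul_actL := fun a b x => Subtype.ext (X.mul_actL a b x)
  actR_one := fun x => Subtype.ext (X.actR_one x)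
  actR_mul := fun x a b => Subtype.ext (X.actR_mul x a b)
  actR_actL := fun a x b => Subtype.ext (X.actR_actL a x b)
  counitL := fun x => by
    apply K.injective_subtype
    rw [← nat_counitL, subCoactL_spec, X.counitL]
  coassocL := fun x => by
    apply Module.Flat.lTensor_preserves_injective_linearMap _ (X.injL K)
    rw [← nat_coassocL, subCoactL_spec, X.coassocL,
      ← nat_coactLL K.subtype (fun y => (X.subCoactL_spec K hK y).symm), subCoactL_spec]
  counitR := fun x => by
    apply K.injective_subtype
    rw [← nat_counitR, subCoactR_spec, X.counitR]
  coassocR := fun x => by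
    apply Module.Flat.rTensor_preserves_injective_linearMap (M := A ⊗[k] A) _ K.injective_subtype
    rw [← nat_coassocR, subCoactR_spec, ← X.coassocR,
      ← nat_coactRR K.subtype (fun y => (X.subCoactR_spec K hK y).symm), subCoactR_spec]
  coactL_coactR := fun x => by
    apply Module.Flat.lTensor_preserves_injective_linearMap _ (X.injR K)
    rw [← nat_coactLR K.subtype (fun y => (X.subCoactR_spec K hK y).symm), subCoactL_spec,
      ← X.coactL_coactR,
      ← nat_coactRL K.subtype (fun y => (X.subCoactL_spec K hK y).symm), subCoactR_spec]
  coactL_actL := fun a x => by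
    apply X.injL K
    rw [← nat_actLL K.subtype (aY := X.actL) (fun _ _ => rfl), subCoactL_spec, subCoactL_spec]
    exact X.coactL_actL a x
  coactL_actR := fun x a => by
    apply X.injL K
    rw [← nat_actLR K.subtype (aY := X.actR) (fun _ _ => rfl), subCoactL_spec, subCoactL_spec]
    exact X.coactL_actR x a
  coactR_actL := fun a x => by
    apply X.injR K
    rw [← nat_actRL K.subtype (aY := X.actL) (fun _ _ => rfl), subCoactR_spec, subCoactR_spec]
    exact X.coactR_actL a x
  coactR_actR := fun x a => by
    apply X.injR K
    rw [← nat_actRR K.subtype (aY := X.actR) (fun _ _ => rfl), subCoactR_spec, subCoactR_spec]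
    exact X.coactR_actR x a

/-- The inclusion of a subtetramodule. -/
def subIncl : X.sub K hK ⟶ X :=
  Hom.mk (M := X.sub K hK) K.subtype (fun _ _ => rfl) (fun _ _ => rfl)
    (fun x => (X.subCoactL_spec K hK x).symm) (fun x => (X.subCoactR_spec K hK x).symm)

end quotient

section maps

theorem lTensor_square {P Q Q' R : Type v} [AddCommGroup P] [AddCommGroup Q] [AddCommGroup Q']
    [AddCommGroup R] [Module k P] [Module k Q] [Module k Q'] [Module k R] {f : P →ₗ[k] Q}
    {g : Q →ₗ[k] R} {f' : P →ₗ[k] Q'} {g' : Q' →ₗ[k] R} (h : ∀ x, g (f x) = g' (f' x))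
    (u : A ⊗[k] P) : g.lTensor A (f.lTensor A u) = g'.lTensor A (f'.lTensor A u) := by
  induction u using ind₁ with
  | add _ _ h h' => simp only [map_add, h, h']
  | tmul a x => simp [h]

theorem rTensor_square {P Q Q' R : Type v} [AddCommGroup P] [AddCommGroup Q] [AddCommGroup Q']
    [AddCommGroup R] [Module k P] [Module k Q] [Module k Q'] [Module k R] {f : P →ₗ[k] Q}
    {g : Q →ₗ[k] R} {f' : P →ₗ[k] Q'} {g' : Q' →ₗ[k] R} (h : ∀ x, g (f x) = g' (f' x))
    (u : P ⊗[k] A) : g.rTensor A (f.rTensor A u) = g'.rTensor A (f'.rTensor A u) := by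
  induction u using ind₁ with
  | add _ _ h h' => simp only [map_add, h, h']
  | tmul a x => simp [h]

variable {X Y : Tetramodule k A} (φ : X ⟶ Y) (K : Submodule k X) (hK : IsSubtetramodule X K)
  (L : Submodule k Y) (hL : IsSubtetramodule Y L) (h : ∀ x ∈ K, lin φ x ∈ L)

/-- The morphism of quotients induced by a morphism of tetramodules. -/
def quotientMap : X.quotient K hK ⟶ Y.quotient L hL :=
  Hom.mk (M := X.quotient K hK) (N := Y.quotient L hL) (K.mapQ L (lin φ) h)
    (fun a m => by
      obtain ⟨x, rfl⟩ := K.mkQ_surjective m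
      exact congrArg L.mkQ (lin_actL φ a x))
    (fun m a => by
      obtain ⟨x, rfl⟩ := K.mkQ_surjective m
      exact congrArg L.mkQ (lin_actR φ x a))
    (fun m => by
      obtain ⟨x, rfl⟩ := K.mkQ_surjective m
      exact (congrArg (L.mkQ.lTensor A) (lin_coactL φ x)).trans
        (lTensor_square (f := lin φ) (g := L.mkQ) (f' := K.mkQ) (g' := K.mapQ L (lin φ) h)
          (fun _ => rfl) _))
    (fun m => by
      obtain ⟨x, rfl⟩ := K.mkQ_surjective m
      exact (congrArg (L.mkQ.rTensor A) (lin_coactR φ x)).trans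
        (rTensor_square (f := lin φ) (g := L.mkQ) (f' := K.mkQ) (g' := K.mapQ L (lin φ) h)
          (fun _ => rfl) _))

/-- The morphism of subtetramodules obtained by restricting a morphism of tetramodules. -/
def subMap : X.sub K hK ⟶ Y.sub L hL :=
  Hom.mk (M := X.sub K hK) (N := Y.sub L hL) ((lin φ).restrict h)
    (fun a (x : K) => Subtype.ext (lin_actL φ a x.1))
    (fun (x : K) a => Subtype.ext (lin_actR φ x.1 a))
    (fun (x : K) => by
      apply Y.injL L
      refine (Y.subCoactL_spec L hL _).trans ((lin_coactL φ x.1).trans ?_)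
      exact (congrArg _ (X.subCoactL_spec K hK x).symm).trans
        (lTensor_square (f := K.subtype) (g := lin φ) (f' := (lin φ).restrict h)
          (g' := L.subtype) (fun _ => rfl) _))
    (fun (x : K) => by
      apply Y.injR L
      refine (Y.subCoactR_spec L hL _).trans ((lin_coactR φ x.1).trans ?_)
      exact (congrArg _ (X.subCoactR_spec K hK x).symm).trans
        (rTensor_square (f := K.subtype) (g := lin φ) (f' := (lin φ).restrict h)
          (g' := L.subtype) (fun _ => rfl) _))

end maps

/-! ### The first tensor product -/

section tensor₁

variable (M N : Tetramodule k A)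

/-- The span of the elements `(m * a) ⊠₁ n - m ⊠₁ (a * n)` of `M ⊠₁ N`. -/
def balancing : Submodule k (external₁ M N) :=
  Submodule.span k {x | ∃ (m : M) (a : A) (n : N), x = M.actR m a ⊗ₜ[k] n - m ⊗ₜ[k] N.actL a n}

theorem relator_mem (m : M) (a : A) (n : N) :
    (M.actR m a ⊗ₜ[k] n - m ⊗ₜ[k] N.actL a n : M ⊗[k] N) ∈ balancing M N :=
  Submodule.subset_span ⟨m, a, n, rfl⟩

theorem balancing_isSub : IsSubtetramodule (external₁ M N) (balancing M N) where
  actL_mem a x hx := by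
    induction hx using Submodule.span_induction with
    | zero => rw [map_zero]; exact zero_mem _
    | add x y _ _ hx hy => rw [map_add]; exact add_mem hx hy
    | smul c x _ hx => rw [map_smul]; exact Submodule.smul_mem _ _ hx
    | mem x hx =>
      obtain ⟨m, b, n, rfl⟩ := hx
      have := relator_mem M N (M.actL a m) b n
      rw [M.actR_actL] at this
      exact (congrArg (· ∈ balancing M N)
        (map_sub (external₁ActL M N a) (M.actR m b ⊗ₜ[k] n) (m ⊗ₜ[k] N.actL b n))).mpr this
  actR_mem x hx a := by
    induction hx using Submodule.span_induction with
    | zero => rw [map_zero]; exact zero_mem _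
    | add x y _ _ hx hy => rw [map_add]; exact add_mem hx hy
    | smul c x _ hx => rw [map_smul]; exact Submodule.smul_mem _ _ hx
    | mem x hx =>
      obtain ⟨m, b, n, rfl⟩ := hx
      have := relator_mem M N m b (N.actR n a)
      rw [← N.actR_actL] at this
      exact (congrArg (· ∈ balancing M N) (map_sub ((external₁ActR M N).flip a)
        (M.actR m b ⊗ₜ[k] n) (m ⊗ₜ[k] N.actL b n))).mpr this
  coactL_mem x hx := by
    induction hx using Submodule.span_induction with
    | zero => rw [map_zero]; exact zero_mem _
    | add x y _ _ hx hy => rw [map_add]; exact add_mem hx hy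
    | smul c x _ hx => rw [map_smul]; exact Submodule.smul_mem _ _ hx
    | mem x hx =>
      obtain ⟨m, b, n, rfl⟩ := hx
      change external₁CoactL M N _ ∈ _
      rw [map_sub, external₁CoactL_tmul, external₁CoactL_tmul, M.coactL_actR, N.coactL_actL]
      generalize (comul b : A ⊗[k] A) = z
      generalize M.coactL m = u
      generalize N.coactL n = w
      induction z, u, w using ind₃ with
      | add₁ _ _ _ _ h h' | add₂ _ _ _ _ h h' | add₃ _ _ _ _ h h' =>
        simp only [map_add, LinearMap.add_apply]
        rw [add_sub_add_comm]
        exact add_mem h h'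
      | tmul c d a m e n =>
        refine ⟨(a * c * e) ⊗ₜ ⟨_, relator_mem M N m d n⟩, ?_⟩
        refine (lTensor_tmul _ _ _ _).trans ?_
        simp only [map₂_apply_tmul, map_tmul,
          mul_apply', mk_apply, mul_assoc]
        exact tmul_sub _ _ _
  coactR_mem x hx := by
    induction hx using Submodule.span_induction with
    | zero => rw [map_zero]; exact zero_mem _
    | add x y _ _ hx hy => rw [map_add]; exact add_mem hx hy
    | smul c x _ hx => rw [map_smul]; exact Submodule.smul_mem _ _ hx
    | mem x hx =>
      obtain ⟨m, b, n, rfl⟩ := hx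
      change external₁CoactR M N _ ∈ _
      rw [map_sub, external₁CoactR_tmul, external₁CoactR_tmul, M.coactR_actR, N.coactR_actL]
      generalize (comul b : A ⊗[k] A) = z
      generalize M.coactR m = u
      generalize N.coactR n = w
      induction z, u, w using ind₃ with
      | add₁ _ _ _ _ h h' | add₂ _ _ _ _ h h' | add₃ _ _ _ _ h h' =>
        simp only [map_add, LinearMap.add_apply]
        rw [add_sub_add_comm]
        exact add_mem h h'
      | tmul c d m a n e =>
        refine ⟨⟨_, relator_mem M N m c n⟩ ⊗ₜ (a * d * e), ?_⟩
        refine (rTensor_tmul _ _ _ _).trans ?_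
        simp only [map₂_apply_tmul, map_tmul,
          mul_apply', mk_apply, mul_assoc]
        exact sub_tmul _ _ _

/-- `M ⊗₁ N`, the quotient tetramodule of `M ⊠₁ N` by the elements
`(m * a) ⊠₁ n - m ⊠₁ (a * n)`. -/
def tensor₁ : Tetramodule k A := (external₁ M N).quotient (balancing M N) (balancing_isSub M N)

/-- The projection `M ⊠₁ N ⟶ M ⊗₁ N`. -/
def proj₁ : external₁ M N ⟶ tensor₁ M N := quotientProj _ _ _

end tensor₁

/-! ### The second tensor product -/

section tensor₂

variable (M N : Tetramodule k A)

/-- The map `M ⊗ N → M ⊗ A ⊗ N`, `m ⊗ n ↦ Δ_r(m) ⊗ n`. -/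
def cotensorLeft : M ⊗[k] N →ₗ[k] M ⊗[k] (A ⊗[k] N) :=
  (assoc k M A N).toLinearMap ∘ₗ M.coactR.rTensor N

/-- The map `M ⊗ N → M ⊗ A ⊗ N`, `m ⊗ n ↦ m ⊗ Δ_ℓ(n)`. -/
def cotensorRight : M ⊗[k] N →ₗ[k] M ⊗[k] (A ⊗[k] N) := N.coactL.lTensor M

theorem cotensorLeft_tmul (m : M) (n : N) : cotensorLeft M N (m ⊗ₜ n) =
    assoc k M A N (M.coactR m ⊗ₜ n) := rfl

theorem cotensorRight_tmul (m : M) (n : N) :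
    cotensorRight M N (m ⊗ₜ n) = m ⊗ₜ N.coactL n := rfl

/-- The subspace of those `∑ mᵢ ⊠₂ nᵢ` with `∑ Δ_r(mᵢ) ⊗ nᵢ = ∑ mᵢ ⊗ Δ_ℓ(nᵢ)`. -/
def cotensor : Submodule k (external₂ M N) :=
  LinearMap.eqLocus (cotensorLeft M N) (cotensorRight M N)

theorem cotensorLeft_actL (a : A) (x : M ⊗[k] N) :
    cotensorLeft M N (external₂ActL M N a x) =
    map₂ M.actL (map₂ (LinearMap.mul k A) N.actL)
      (comul.lTensor A (comul a)) (cotensorLeft M N x) := by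
  rw [← coassoc_apply, external₂ActL_apply]
  induction x using ind₁ with
  | add _ _ h h' => simp only [map_add, h, h']
  | tmul m n =>
    rw [cotensorLeft_tmul]
    generalize (comul a : A ⊗[k] A) = z
    induction z using ind₁ with
    | add _ _ h h' => simp only [map_add, LinearMap.add_apply, h, h']
    | tmul b c =>
      simp only [map₂_apply_tmul, map_tmul, cotensorLeft_tmul,
        M.coactR_actL, rTensor_tmul]
      generalize (comul b : A ⊗[k] A) = z
      generalize M.coactR m = u
      induction z, u using ind₂ with
      | addl _ _ _ h h' | addr _ _ _ h h' =>
        simp only [map_add, LinearMap.add_apply, add_tmul, h, h']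
      | tmul b b' m d => simp

theorem cotensorRight_actL (a : A) (x : M ⊗[k] N) :
    cotensorRight M N (external₂ActL M N a x) =
    map₂ M.actL (map₂ (LinearMap.mul k A) N.actL)
      (comul.lTensor A (comul a)) (cotensorRight M N x) := by
  rw [external₂ActL_apply]
  induction x using ind₁ with
  | add _ _ h h' => simp only [map_add, h, h']
  | tmul m n =>
    generalize (comul a : A ⊗[k] A) = z
    induction z using ind₁ with
    | add _ _ h h' => simp only [map_add, LinearMap.add_apply, h, h']
    | tmul b c => simp [cotensorRight_tmul, N.coactL_actL]

theorem cotensorLeft_actR (x : M ⊗[k] N) (a : A) :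
    cotensorLeft M N (external₂ActR M N x a) =
    map₂ M.actR (map₂ (LinearMap.mul k A) N.actR)
      (cotensorLeft M N x) (comul.lTensor A (comul a)) := by
  rw [← coassoc_apply, external₂ActR_apply]
  induction x using ind₁ with
  | add _ _ h h' => simp only [map_add, LinearMap.add_apply, h, h']
  | tmul m n =>
    rw [cotensorLeft_tmul]
    generalize (comul a : A ⊗[k] A) = z
    induction z using ind₁ with
    | add _ _ h h' => simp only [map_add, h, h']
    | tmul b c =>
      simp only [map₂_apply_tmul, map_tmul, cotensorLeft_tmul,
        M.coactR_actR, rTensor_tmul]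
      generalize (comul b : A ⊗[k] A) = z
      generalize M.coactR m = u
      induction z, u using ind₂ with
      | addl _ _ _ h h' | addr _ _ _ h h' =>
        simp only [map_add, add_tmul, LinearMap.add_apply, h, h']
      | tmul b b' m d => simp

theorem cotensorRight_actR (x : M ⊗[k] N) (a : A) :
    cotensorRight M N (external₂ActR M N x a) =
    map₂ M.actR (map₂ (LinearMap.mul k A) N.actR)
      (cotensorRight M N x) (comul.lTensor A (comul a)) := by
  rw [external₂ActR_apply]
  induction x using ind₁ with
  | add _ _ h h' => simp only [map_add, LinearMap.add_apply, h, h']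
  | tmul m n =>
    generalize (comul a : A ⊗[k] A) = z
    induction z using ind₁ with
    | add _ _ h h' => simp only [map_add, h, h']
    | tmul b c => simp [cotensorRight_tmul, N.coactL_actR]

theorem cotensorLeft_coactL (x : M ⊗[k] N) :
    (cotensorLeft M N).lTensor A (external₂CoactL M N x) =
    assoc k A M (A ⊗[k] N) (M.coactL.rTensor (A ⊗[k] N) (cotensorLeft M N x)) := by
  induction x using ind₁ with
  | add _ _ h h' => simp only [map_add, h, h']
  | tmul m n =>
    rw [external₂CoactL_tmul, cotensorLeft_tmul]
    trans (assoc k M A N).toLinearMap.lTensor A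
      (assoc k A (M ⊗[k] A) N (M.coactR.lTensor A (M.coactL m) ⊗ₜ n))
    · generalize M.coactL m = u
      induction u using ind₁ with
      | add _ _ h h' => simp only [map_add, add_tmul, h, h']
      | tmul a m => simp [cotensorLeft_tmul]
    · rw [← M.coactL_coactR]
      generalize M.coactR m = u
      induction u using ind₁ with
      | add _ _ h h' => simp only [map_add, add_tmul, h, h']
      | tmul m a =>
        simp only [assoc_tmul, rTensor_tmul]
        generalize M.coactL m = z
        induction z using ind₁ with
        | add _ _ h h' => simp only [map_add, add_tmul, h, h']
        | tmul a b => simp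

theorem cotensorRight_coactL (x : M ⊗[k] N) :
    (cotensorRight M N).lTensor A (external₂CoactL M N x) =
    assoc k A M (A ⊗[k] N)
      (M.coactL.rTensor (A ⊗[k] N) (cotensorRight M N x)) := by
  induction x using ind₁ with
  | add _ _ h h' => simp only [map_add, h, h']
  | tmul m n =>
    rw [external₂CoactL_tmul, cotensorRight_tmul, rTensor_tmul]
    generalize M.coactL m = u
    induction u using ind₁ with
    | add _ _ h h' => simp only [map_add, add_tmul, h, h']
    | tmul a m => simp [cotensorRight_tmul]

theorem cotensorLeft_coactR (x : M ⊗[k] N) :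
    (cotensorLeft M N).rTensor A (external₂CoactR M N x) =
    (assoc k M (A ⊗[k] N) A).symm
      (((assoc k A N A).symm.toLinearMap ∘ₗ N.coactR.lTensor A).lTensor M
        (cotensorLeft M N x)) := by
  induction x using ind₁ with
  | add _ _ h h' => simp only [map_add, h, h']
  | tmul m n =>
    have h₁ : ∀ w : N ⊗[k] A, (cotensorLeft M N).rTensor A
        ((assoc k M N A).symm (m ⊗ₜ w)) =
        ((assoc k M A N).toLinearMap ∘ₗ
          TensorProduct.mk k _ _ (M.coactR m)).rTensor A w := fun w => by
      induction w using ind₁ with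
      | add _ _ h h' => simp only [map_add, tmul_add, h, h']
      | tmul n a => simp [cotensorLeft_tmul]
    have h₂ : ∀ u : M ⊗[k] A,
        ((assoc k A N A).symm.toLinearMap ∘ₗ N.coactR.lTensor A).lTensor M
          (assoc k M A N (u ⊗ₜ n)) =
        (assoc k A N A).symm.toLinearMap.lTensor M
          (assoc k M A (N ⊗[k] A) (u ⊗ₜ N.coactR n)) := fun u => by
      induction u using ind₁ with
      | add _ _ h h' => simp only [map_add, add_tmul, h, h']
      | tmul a m => simp
    rw [cotensorLeft_tmul, external₂CoactR_tmul, h₁, h₂]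
    generalize M.coactR m = u
    generalize N.coactR n = w
    induction w, u using ind₂ with
    | addl _ _ _ h h' | addr _ _ _ h h' =>
      simp only [map_add, tmul_add, LinearMap.comp_add, LinearMap.rTensor_add,
        LinearMap.add_apply, add_tmul, h, h']
    | tmul n a b m => simp

theorem cotensorRight_coactR (x : M ⊗[k] N) :
    (cotensorRight M N).rTensor A (external₂CoactR M N x) =
    (assoc k M (A ⊗[k] N) A).symm
      (((assoc k A N A).symm.toLinearMap ∘ₗ N.coactR.lTensor A).lTensor M
        (cotensorRight M N x)) := by
  induction x using ind₁ with
  | add _ _ h h' => simp only [map_add, h, h']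
  | tmul m n =>
    rw [external₂CoactR_tmul, cotensorRight_tmul, lTensor_tmul, LinearMap.comp_apply,
      ← N.coactL_coactR]
    generalize N.coactR n = w
    induction w using ind₁ with
    | add _ _ h h' => simp only [map_add, tmul_add, h, h']
    | tmul n a => simp [cotensorRight_tmul]

theorem cotensor_coactL (x : M ⊗[k] N) (hx : cotensorLeft M N x = cotensorRight M N x) :
    (cotensorLeft M N - cotensorRight M N).lTensor A (external₂CoactL M N x) = 0 := by
  rw [LinearMap.lTensor_sub, LinearMap.sub_apply, cotensorLeft_coactL, cotensorRight_coactL,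
    hx, sub_self]

theorem cotensor_coactR (x : M ⊗[k] N) (hx : cotensorLeft M N x = cotensorRight M N x) :
    (cotensorLeft M N - cotensorRight M N).rTensor A (external₂CoactR M N x) = 0 := by
  rw [LinearMap.rTensor_sub, LinearMap.sub_apply, cotensorLeft_coactR, cotensorRight_coactR,
    hx, sub_self]

theorem mem_cotensor (x : M ⊗[k] N) :
    x ∈ cotensor M N ↔ cotensorLeft M N x = cotensorRight M N x := Iff.rfl

theorem cotensor_exact : Function.Exact (cotensor M N).subtype
    (cotensorLeft M N - cotensorRight M N) := fun x => by
  refine Iff.trans ?_ (Set.ext_iff.mp (Subtype.range_coe (s := (cotensor M N : Set _))) x).symm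
  exact sub_eq_zero

theorem cotensor_isSub : IsSubtetramodule (external₂ M N) (cotensor M N) where
  actL_mem a x hx := by
    refine (cotensorLeft_actL M N a x).trans (Eq.trans ?_ (cotensorRight_actL M N a x).symm)
    rw [(mem_cotensor M N x).mp hx]
  actR_mem x hx a := by
    refine (cotensorLeft_actR M N x a).trans (Eq.trans ?_ (cotensorRight_actR M N x a).symm)
    rw [(mem_cotensor M N x).mp hx]
  coactL_mem x hx := by
    exact (Module.Flat.lTensor_exact A (cotensor_exact M N) _).mp
      (cotensor_coactL M N x ((mem_cotensor M N x).mp hx))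
  coactR_mem x hx := by
    exact (Module.Flat.rTensor_exact A (cotensor_exact M N) _).mp
      (cotensor_coactR M N x ((mem_cotensor M N x).mp hx))

/-- `M ⊗₂ N`, the subtetramodule of `M ⊠₂ N` of those `∑ mᵢ ⊠₂ nᵢ` with
`∑ Δ_r(mᵢ) ⊗ nᵢ = ∑ mᵢ ⊗ Δ_ℓ(nᵢ)`. -/
def tensor₂ : Tetramodule k A := (external₂ M N).sub (cotensor M N) (cotensor_isSub M N)

/-- The inclusion `M ⊗₂ N ⟶ M ⊠₂ N`. -/
def incl₂ : tensor₂ M N ⟶ external₂ M N := subIncl _ _ _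

end tensor₂

/-! ### Functoriality -/

section functoriality

variable {M M' N N' : Tetramodule k A} (f : M ⟶ M') (g : N ⟶ N')

/-- `f ⊠₁ g`. -/
def external₁Map : external₁ M N ⟶ external₁ M' N' :=
  Hom.mk (M := external₁ M N) (N := external₁ M' N') (map (lin f) (lin g))
    (fun a (x : M ⊗[k] N) => by
      change map (lin f) (lin g) (external₁ActL M N a x) =
        external₁ActL M' N' a (map (lin f) (lin g) x)
      induction x using ind₁ with
      | add _ _ h h' => simp only [map_add, h, h']
      | tmul m n => simp [lin_actL])
    (fun (x : M ⊗[k] N) a => by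
      change map (lin f) (lin g) (external₁ActR M N x a) =
        external₁ActR M' N' (map (lin f) (lin g) x) a
      induction x using ind₁ with
      | add _ _ h h' => simp only [map_add, LinearMap.add_apply, h, h']
      | tmul m n => simp [lin_actR])
    (fun (x : M ⊗[k] N) => by
      change external₁CoactL M' N' (map (lin f) (lin g) x) =
        (map (lin f) (lin g)).lTensor A (external₁CoactL M N x)
      induction x using ind₁ with
      | add _ _ h h' => simp only [map_add, h, h']
      | tmul m n =>
        simp only [map_tmul, external₁CoactL_tmul, lin_coactL]
        generalize M.coactL m = u
        generalize N.coactL n = w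
        induction u, w using ind₂ with
        | addl _ _ _ h h' | addr _ _ _ h h' => simp only [map_add, LinearMap.add_apply, h, h']
        | tmul a m b n => simp)
    (fun (x : M ⊗[k] N) => by
      change external₁CoactR M' N' (map (lin f) (lin g) x) =
        (map (lin f) (lin g)).rTensor A (external₁CoactR M N x)
      induction x using ind₁ with
      | add _ _ h h' => simp only [map_add, h, h']
      | tmul m n =>
        simp only [map_tmul, external₁CoactR_tmul, lin_coactR]
        generalize M.coactR m = u
        generalize N.coactR n = w
        induction u, w using ind₂ with
        | addl _ _ _ h h' | addr _ _ _ h h' => simp only [map_add, LinearMap.add_apply, h, h']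
        | tmul a m b n => simp)

/-- `f ⊠₂ g`. -/
def external₂Map : external₂ M N ⟶ external₂ M' N' :=
  Hom.mk (M := external₂ M N) (N := external₂ M' N') (map (lin f) (lin g))
    (fun a (x : M ⊗[k] N) => by
      change map (lin f) (lin g) (external₂ActL M N a x) =
        external₂ActL M' N' a (map (lin f) (lin g) x)
      simp only [external₂ActL_apply]
      generalize (comul a : A ⊗[k] A) = z
      induction x, z using ind₂ with
      | addl _ _ _ h h' | addr _ _ _ h h' => simp only [map_add, LinearMap.add_apply, h, h']
      | tmul m n a b => simp [lin_actL])
    (fun (x : M ⊗[k] N) a => by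
      change map (lin f) (lin g) (external₂ActR M N x a) =
        external₂ActR M' N' (map (lin f) (lin g) x) a
      simp only [external₂ActR_apply]
      generalize (comul a : A ⊗[k] A) = z
      induction x, z using ind₂ with
      | addl _ _ _ h h' | addr _ _ _ h h' => simp only [map_add, LinearMap.add_apply, h, h']
      | tmul m n a b => simp [lin_actR])
    (fun (x : M ⊗[k] N) => by
      change external₂CoactL M' N' (map (lin f) (lin g) x) =
        (map (lin f) (lin g)).lTensor A (external₂CoactL M N x)
      induction x using ind₁ with
      | add _ _ h h' => simp only [map_add, h, h']
      | tmul m n =>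
        simp only [map_tmul, external₂CoactL_tmul, lin_coactL]
        generalize M.coactL m = u
        induction u using ind₁ with
        | add _ _ h h' => simp only [map_add, add_tmul, h, h']
        | tmul a m => simp)
    (fun (x : M ⊗[k] N) => by
      change external₂CoactR M' N' (map (lin f) (lin g) x) =
        (map (lin f) (lin g)).rTensor A (external₂CoactR M N x)
      induction x using ind₁ with
      | add _ _ h h' => simp only [map_add, h, h']
      | tmul m n =>
        simp only [map_tmul, external₂CoactR_tmul, lin_coactR]
        generalize N.coactR n = u
        induction u using ind₁ with
        | add _ _ h h' => simp only [map_add, tmul_add, h, h']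
        | tmul n a => simp)

theorem balancing_map (x : external₁ M N) (hx : x ∈ balancing M N) :
    lin (external₁Map f g) x ∈ balancing M' N' := by
  induction hx using Submodule.span_induction with
  | zero => rw [map_zero]; exact zero_mem _
  | add x y _ _ hx hy => rw [map_add]; exact add_mem hx hy
  | smul c x _ hx => rw [map_smul]; exact Submodule.smul_mem _ _ hx
  | mem x hx =>
    obtain ⟨m, b, n, rfl⟩ := hx
    have := relator_mem M' N' (lin f m) b (lin g n)
    rw [← lin_actR, ← lin_actL] at this
    exact (congrArg (· ∈ balancing M' N') (map_sub (map (lin f) (lin g))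
      (M.actR m b ⊗ₜ[k] n) (m ⊗ₜ[k] N.actL b n))).mpr this

theorem cotensor_map (x : external₂ M N) (hx : x ∈ cotensor M N) :
    lin (external₂Map f g) x ∈ cotensor M' N' := by
  have h₁ : ∀ y : M ⊗[k] N, cotensorLeft M' N' (map (lin f) (lin g) y) =
      map (lin f) ((lin g).lTensor A) (cotensorLeft M N y) := fun y => by
    induction y using ind₁ with
    | add _ _ h h' => simp only [map_add, h, h']
    | tmul m n =>
      simp only [map_tmul, cotensorLeft_tmul, lin_coactR]
      generalize M.coactR m = u
      induction u using ind₁ with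
      | add _ _ h h' => simp only [map_add, add_tmul, h, h']
      | tmul m a => simp
  have h₂ : ∀ y : M ⊗[k] N, cotensorRight M' N' (map (lin f) (lin g) y) =
      map (lin f) ((lin g).lTensor A) (cotensorRight M N y) := fun y => by
    induction y using ind₁ with
    | add _ _ h h' => simp only [map_add, h, h']
    | tmul m n => simp only [map_tmul, cotensorRight_tmul, lin_coactL]
  refine (h₁ x).trans (Eq.trans ?_ (h₂ x).symm)
  rw [(mem_cotensor M N x).mp hx]

/-- `f ⊗₁ g`, induced by `f ⊠₁ g` on the quotients. -/
def tensor₁Map : tensor₁ M N ⟶ tensor₁ M' N' :=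
  quotientMap (external₁Map f g) _ _ _ _ (balancing_map f g)

/-- `f ⊗₂ g`, the restriction of `f ⊠₂ g`. -/
def tensor₂Map : tensor₂ M N ⟶ tensor₂ M' N' :=
  subMap (external₂Map f g) _ _ _ _ (cotensor_map f g)

end functoriality

variable (k A) in
/-- The bifunctor `⊗₁`. -/
def tensorFunctor₁ : Tetramodule k A × Tetramodule k A ⥤ Tetramodule k A where
  obj X := tensor₁ X.1 X.2
  map f := tensor₁Map f.1 f.2
  map_id X := by
    ext x
    obtain ⟨x, rfl⟩ := (balancing X.1 X.2).mkQ_surjective x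
    exact congrArg (balancing X.1 X.2).mkQ (DFunLike.congr_fun TensorProduct.map_id x)
  map_comp {X Y Z} f g := by
    ext x
    obtain ⟨x, rfl⟩ := (balancing X.1 X.2).mkQ_surjective x
    exact congrArg (balancing Z.1 Z.2).mkQ (DFunLike.congr_fun
      (TensorProduct.map_comp (lin g.1) (lin g.2) (lin f.1) (lin f.2)) x)

variable (k A) in
/-- The bifunctor `⊗₂`. -/
def tensorFunctor₂ : Tetramodule k A × Tetramodule k A ⥤ Tetramodule k A where
  obj X := tensor₂ X.1 X.2
  map f := tensor₂Map f.1 f.2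
  map_id X := by
    ext x
    exact Subtype.ext (DFunLike.congr_fun TensorProduct.map_id x.1)
  map_comp {X Y Z} f g := by
    ext x
    exact Subtype.ext (DFunLike.congr_fun
      (TensorProduct.map_comp (lin g.1) (lin g.2) (lin f.1) (lin f.2)) x.1)



/-- The projection `M ⊠₁ N → M ⊗₁ N` as a linear map on `M ⊗ N`. -/
def linProj₁ (M N : Tetramodule k A) : M ⊗[k] N →ₗ[k] tensor₁ M N := lin (proj₁ M N)

/-- The inclusion `M ⊗₂ N → M ⊠₂ N` as a linear map to `M ⊗ N`. -/
def linIncl₂ (M N : Tetramodule k A) : tensor₂ M N →ₗ[k] M ⊗[k] N := lin (incl₂ M N)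

end Tetramodule

end

/-!
Everything takes place inside tensor products over the field `k`, where the structure maps are the
obvious ones; the work lies in descending along the projection `M ⊠₁ N → M ⊗₁ N` and restricting
along the inclusion `M ⊗₂ N → M ⊠₂ N`.

A morphism out of `M ⊗₁ N` is the same as a balanced bilinear map which is compatible with the
outer actions and multiplicative for the coactions (`desc₁`), and it is determined by its values
on the classes `tens₁ M N m n`. The associativity and unit isomorphisms of `⊗₁` and all the
identities between them are therefore read off on such classes, as for bimodules.

Dually, a map into `M ⊗₂ N` is determined by its composite with the injection `linIncl₂ M N`.
Since `k` is a field, every tensor product over `k` is exact, so inside `M ⊗ N ⊗ P` both `(M ⊗₂ N)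
⊗₂ P` and `M ⊗₂ (N ⊗₂ P)` are the subspace cut out by the two conditions `Δ_r(m) ⊗ n ⊗ p = m ⊗
Δ_ℓ(n) ⊗ p` and `m ⊗ Δ_r(n) ⊗ p = m ⊗ n ⊗ Δ_ℓ(p)` (`range_inclLeft₂`); this gives the
associativity isomorphism `assoc₂`. The coaction `M → A ⊗ M` takes values in the cotensor product
by coassociativity, and the counit inverts it there (`coactL_counitL₂`).

For the interchange, the bilinear map `(∑ m ⊗ n, ∑ p ⊗ q) ↦ ∑ (m ⊗₁ p) ⊗ (n ⊗₁ q)` takes values in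
the cotensor product because the coactions of `⊗₁` are multiplicative (`interchangeBilin`), and it
is balanced because the actions of `⊗₂` are diagonal (`interchange`). By `linIncl₂_interchange` it
becomes the swap of the middle factors in the tensor products over `k`, so the coherence
conditions reduce to identities between linear maps that are checked on pure tensors.
-/

noncomputable section

namespace Tetramodule

open TensorProduct (add_tmul assoc assoc_tmul lid map map_tmul map₂ map₂_apply_tmul rid tmul_add)
open LinearMap (lTensor_tmul rTensor_tmul)
open Coalgebra (comul counit)

variable {k : Type u} {A : Type v} [Field k] [Ring A] [Bialgebra k A]

/-! ### Isomorphisms of tetramodules -/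

/-- A morphism of tetramodules with a linear inverse is an isomorphism. -/
def isoOfInverse {M N : Tetramodule k A} (f : M ⟶ N) (g : N →ₗ[k] M)
    (hgf : ∀ m, g (lin f m) = m) (hfg : ∀ n, lin f (g n) = n) : M ≅ N where
  hom := f
  inv := Hom.mk g
    (fun a n => by rw [← hgf (M.actL a (g n)), lin_actL, hfg])
    (fun n a => by rw [← hgf (M.actR (g n) a), lin_actR, hfg])
    (fun n => by
      conv_rhs => rw [← hfg n, lin_coactL]
      rw [← LinearMap.comp_apply (g.lTensor A), ← LinearMap.lTensor_comp,
        show g ∘ₗ lin f = LinearMap.id from LinearMap.ext hgf, LinearMap.lTensor_id]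
      rfl)
    (fun n => by
      conv_rhs => rw [← hfg n, lin_coactR]
      rw [← LinearMap.comp_apply (g.rTensor A), ← LinearMap.rTensor_comp,
        show g ∘ₗ lin f = LinearMap.id from LinearMap.ext hgf, LinearMap.rTensor_id]
      rfl)
  hom_inv_id := hom_ext (LinearMap.ext hgf)
  inv_hom_id := hom_ext (LinearMap.ext hfg)

/-- A morphism whose image lies in the image of an injective morphism `g` factors through `g`;
compatibility with the coactions uses that `A` is flat over `k`. -/
def factor {X Y Z : Tetramodule k A} (f : X ⟶ Z) (g : Y ⟶ Z) (hg : Function.Injective (lin g))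
    (h : ∀ x, lin f x ∈ LinearMap.range (lin g)) : X ⟶ Y :=
  have spec x : lin g (LinearMap.codRestrictOfInjective (lin f) (lin g) hg h x) = lin f x :=
    LinearMap.codRestrictOfInjective_comp_apply _ _ _ _ x
  have spec' : lin g ∘ₗ LinearMap.codRestrictOfInjective (lin f) (lin g) hg h = lin f :=
    LinearMap.ext spec
  Hom.mk (LinearMap.codRestrictOfInjective (lin f) (lin g) hg h)
    (fun a x => hg (by rw [lin_actL, spec, spec, lin_actL]))
    (fun x a => hg (by rw [lin_actR, spec, spec, lin_actR]))
    (fun x => Module.Flat.lTensor_preserves_injective_linearMap (M := A) _ hg (by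
      rw [← lin_coactL, spec, ← LinearMap.comp_apply ((lin g).lTensor A), ← LinearMap.lTensor_comp,
        spec', lin_coactL]))
    (fun x => Module.Flat.rTensor_preserves_injective_linearMap (M := A) _ hg (by
      rw [← lin_coactR, spec, ← LinearMap.comp_apply ((lin g).rTensor A), ← LinearMap.rTensor_comp,
        spec', lin_coactR]))

theorem lin_factor {X Y Z : Tetramodule k A} (f : X ⟶ Z) (g : Y ⟶ Z)
    (hg : Function.Injective (lin g)) (h : ∀ x, lin f x ∈ LinearMap.range (lin g)) (x : X) :
    lin g (lin (factor f g hg h) x) = lin f x :=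
  LinearMap.codRestrictOfInjective_comp_apply _ _ _ _ x

/-- Two injective morphisms with the same image have isomorphic sources. -/
def isoOfRangeEq {X Y Z : Tetramodule k A} (f : X ⟶ Z) (g : Y ⟶ Z)
    (hf : Function.Injective (lin f)) (hg : Function.Injective (lin g))
    (h : LinearMap.range (lin f) = LinearMap.range (lin g)) : X ≅ Y where
  hom := factor f g hg fun x => h ▸ LinearMap.mem_range_self (lin f) x
  inv := factor g f hf fun y => h ▸ LinearMap.mem_range_self (lin g) y
  hom_inv_id := hom_ext <| LinearMap.ext fun x => hf (by
    simp only [lin_comp, LinearMap.comp_apply, lin_factor, lin_id, LinearMap.id_apply])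
  inv_hom_id := hom_ext <| LinearMap.ext fun y => hg (by
    simp only [lin_comp, LinearMap.comp_apply, lin_factor, lin_id, LinearMap.id_apply])

/-! ### Morphisms out of the first tensor product -/

section tens₁

variable (M N : Tetramodule k A)

/-- The universal balanced bilinear map `M × N → M ⊗₁ N`, sending `(m, n)` to the class of
`m ⊗ n`. -/
def tens₁ : M →ₗ[k] N →ₗ[k] tensor₁ M N := (TensorProduct.mk k M N).compr₂ (linProj₁ M N)

theorem linProj₁_tmul (m : M) (n : N) : linProj₁ M N (m ⊗ₜ n) = tens₁ M N m n := rfl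

theorem tens₁_actR (m : M) (a : A) (n : N) :
    tens₁ M N (M.actR m a) n = tens₁ M N m (N.actL a n) :=
  (Submodule.Quotient.eq _).mpr (relator_mem M N m a n)

theorem actL_tens₁ (a : A) (m : M) (n : N) :
    (tensor₁ M N).actL a (tens₁ M N m n) = tens₁ M N (M.actL a m) n := rfl

theorem actR_tens₁ (m : M) (n : N) (a : A) :
    (tensor₁ M N).actR (tens₁ M N m n) a = tens₁ M N m (N.actR n a) := rfl

theorem coactL_tens₁ (m : M) (n : N) : (tensor₁ M N).coactL (tens₁ M N m n) =
    map₂ (LinearMap.mul k A) (tens₁ M N) (M.coactL m) (N.coactL n) := by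
  change (linProj₁ M N).lTensor A (map₂ (LinearMap.mul k A) (TensorProduct.mk k M N)
    (M.coactL m) (N.coactL n)) = _
  generalize M.coactL m = u
  generalize N.coactL n = w
  induction u, w using ind₂ with
  | addl _ _ _ h h' | addr _ _ _ h h' => simp only [map_add, LinearMap.add_apply, h, h']
  | tmul a m b n => simp [linProj₁_tmul]

theorem coactR_tens₁ (m : M) (n : N) : (tensor₁ M N).coactR (tens₁ M N m n) =
    map₂ (tens₁ M N) (LinearMap.mul k A) (M.coactR m) (N.coactR n) := by
  change (linProj₁ M N).rTensor A (map₂ (TensorProduct.mk k M N) (LinearMap.mul k A)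
    (M.coactR m) (N.coactR n)) = _
  generalize M.coactR m = u
  generalize N.coactR n = w
  induction u, w using ind₂ with
  | addl _ _ _ h h' | addr _ _ _ h h' => simp only [map_add, LinearMap.add_apply, h, h']
  | tmul a m b n => simp [linProj₁_tmul]

variable {M N}

@[elab_as_elim]
theorem tensor₁_induction {p : tensor₁ M N → Prop} (x : tensor₁ M N)
    (tens : ∀ m n, p (tens₁ M N m n)) (add : ∀ x y, p x → p y → p (x + y)) : p x := by
  obtain ⟨x, rfl⟩ := (balancing M N).mkQ_surjective x
  exact ind₁ (k := k) (P := M) (Q := N) (p := fun x => p (linProj₁ M N x)) x tens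
    fun x y hx hy => by rw [map_add]; exact add _ _ hx hy

theorem tensor₁_lin_ext {V : Type*} [AddCommGroup V] [Module k V] {f g : tensor₁ M N →ₗ[k] V}
    (h : ∀ m n, f (tens₁ M N m n) = g (tens₁ M N m n)) : f = g := by
  ext x
  induction x using tensor₁_induction with
  | tens m n => exact h m n
  | add x y hx hy => rw [map_add, map_add, hx, hy]

theorem tensor₁_lin_ext₃ {P : Tetramodule k A} {V : Type*} [AddCommGroup V] [Module k V]
    {f g : tensor₁ (tensor₁ M N) P →ₗ[k] V}
    (h : ∀ m n p, f (tens₁ (tensor₁ M N) P (tens₁ M N m n) p) =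
      g (tens₁ (tensor₁ M N) P (tens₁ M N m n) p)) : f = g :=
  tensor₁_lin_ext fun x p => by
    induction x using tensor₁_induction with
    | add x y hx hy => simp only [map_add, LinearMap.add_apply, hx, hy]
    | tens m n => exact h m n p

theorem tensor₁_lin_ext₄ {P Q : Tetramodule k A} {V : Type*} [AddCommGroup V] [Module k V]
    {f g : tensor₁ (tensor₁ (tensor₁ M N) P) Q →ₗ[k] V}
    (h : ∀ m n p q,
      f (tens₁ (tensor₁ (tensor₁ M N) P) Q (tens₁ (tensor₁ M N) P (tens₁ M N m n) p) q) =
      g (tens₁ (tensor₁ (tensor₁ M N) P) Q (tens₁ (tensor₁ M N) P (tens₁ M N m n) p) q)) :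
    f = g :=
  tensor₁_lin_ext₃ fun x p q => by
    induction x using tensor₁_induction with
    | add x y hx hy => simp only [map_add, LinearMap.add_apply, hx, hy]
    | tens m n => exact h m n p q

/-- The linear map on `M ⊗₁ N` induced by a balanced bilinear map. -/
def lift₁ {V : Type*} [AddCommGroup V] [Module k V] (f : M →ₗ[k] N →ₗ[k] V)
    (hf : ∀ m a n, f (M.actR m a) n = f m (N.actL a n)) : tensor₁ M N →ₗ[k] V :=
  (balancing M N).liftQ (TensorProduct.lift f) (Submodule.span_le.mpr (by
    rintro _ ⟨m, a, n, rfl⟩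
    refine (map_sub (TensorProduct.lift f) (M.actR m a ⊗ₜ[k] n) (m ⊗ₜ[k] N.actL a n)).trans ?_
    simp [hf]))

@[simp] theorem lift₁_tens₁ {V : Type*} [AddCommGroup V] [Module k V] (f : M →ₗ[k] N →ₗ[k] V)
    (hf : ∀ m a n, f (M.actR m a) n = f m (N.actL a n)) (m : M) (n : N) :
    lift₁ f hf (tens₁ M N m n) = f m n := rfl

/-- The morphism of tetramodules `M ⊗₁ N ⟶ P` induced by a balanced bilinear map which is
compatible with the outer actions and multiplicative for both coactions. -/
def desc₁ {P : Tetramodule k A} (f : M →ₗ[k] N →ₗ[k] P)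
    (hf : ∀ m a n, f (M.actR m a) n = f m (N.actL a n))
    (hactL : ∀ a m n, f (M.actL a m) n = P.actL a (f m n))
    (hactR : ∀ m n a, f m (N.actR n a) = P.actR (f m n) a)
    (hcoactL : ∀ m n, P.coactL (f m n) = map₂ (LinearMap.mul k A) f (M.coactL m) (N.coactL n))
    (hcoactR : ∀ m n, P.coactR (f m n) = map₂ f (LinearMap.mul k A) (M.coactR m) (N.coactR n)) :
    tensor₁ M N ⟶ P :=
  Hom.mk (lift₁ f hf)
    (fun a x => by
      induction x using tensor₁_induction with
      | add x y hx hy => simp only [map_add, hx, hy]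
      | tens m n => rw [actL_tens₁, lift₁_tens₁, lift₁_tens₁, hactL])
    (fun x a => by
      induction x using tensor₁_induction with
      | add x y hx hy => simp only [map_add, LinearMap.add_apply, hx, hy]
      | tens m n => rw [actR_tens₁, lift₁_tens₁, lift₁_tens₁, hactR])
    (fun x => by
      induction x using tensor₁_induction with
      | add x y hx hy => simp only [map_add, hx, hy]
      | tens m n =>
        rw [coactL_tens₁, lift₁_tens₁, hcoactL]
        generalize M.coactL m = u
        generalize N.coactL n = w
        induction u, w using ind₂ with
        | addl _ _ _ h h' | addr _ _ _ h h' => simp only [map_add, LinearMap.add_apply, h, h']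
        | tmul a m b n => simp)
    (fun x => by
      induction x using tensor₁_induction with
      | add x y hx hy => simp only [map_add, hx, hy]
      | tens m n =>
        rw [coactR_tens₁, lift₁_tens₁, hcoactR]
        generalize M.coactR m = u
        generalize N.coactR n = w
        induction u, w using ind₂ with
        | addl _ _ _ h h' | addr _ _ _ h h' => simp only [map_add, LinearMap.add_apply, h, h']
        | tmul a m b n => simp)

theorem tensor₁Map_tens₁ {M' N' : Tetramodule k A} (f : M ⟶ M') (g : N ⟶ N') (m : M) (n : N) :
    lin (tensor₁Map f g) (tens₁ M N m n) = tens₁ M' N' (lin f m) (lin g n) := rfl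

end tens₁

/-! ### The first monoidal structure -/

section first

variable (M N P : Tetramodule k A)

/-- The bilinear map `(m ⊗₁ n, p) ↦ m ⊗₁ (n ⊗₁ p)`. -/
def assoc₁Bilin : tensor₁ M N →ₗ[k] P →ₗ[k] tensor₁ M (tensor₁ N P) :=
  lift₁ (((LinearMap.llcomp k P (tensor₁ N P) (tensor₁ M (tensor₁ N P))).comp
      (tens₁ M (tensor₁ N P))).compl₂ (tens₁ N P))
    fun m a n => LinearMap.ext fun p => tens₁_actR M (tensor₁ N P) m a (tens₁ N P n p)

@[simp] theorem assoc₁Bilin_tens₁ (m : M) (n : N) (p : P) :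
    assoc₁Bilin M N P (tens₁ M N m n) p = tens₁ M (tensor₁ N P) m (tens₁ N P n p) := rfl

/-- The morphism `(M ⊗₁ N) ⊗₁ P ⟶ M ⊗₁ (N ⊗₁ P)`. -/
def assoc₁Hom : tensor₁ (tensor₁ M N) P ⟶ tensor₁ M (tensor₁ N P) :=
  desc₁ (assoc₁Bilin M N P)
    (fun x a p => by
      induction x using tensor₁_induction with
      | add x y hx hy => simp only [map_add, LinearMap.add_apply, hx, hy]
      | tens m n => rw [actR_tens₁, assoc₁Bilin_tens₁, assoc₁Bilin_tens₁, tens₁_actR])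
    (fun a x p => by
      induction x using tensor₁_induction with
      | add x y hx hy => simp only [map_add, LinearMap.add_apply, hx, hy]
      | tens m n => rfl)
    (fun x p a => by
      induction x using tensor₁_induction with
      | add x y hx hy => simp only [map_add, LinearMap.add_apply, hx, hy]
      | tens m n => rfl)
    (fun x p => by
      induction x using tensor₁_induction with
      | add x y hx hy => simp only [map_add, LinearMap.add_apply, hx, hy]
      | tens m n =>
        rw [assoc₁Bilin_tens₁, coactL_tens₁, coactL_tens₁, coactL_tens₁]
        generalize M.coactL m = u
        generalize N.coactL n = w
        generalize P.coactL p = z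
        induction u, w, z using ind₃ with
        | add₁ _ _ _ _ h h' | add₂ _ _ _ _ h h' | add₃ _ _ _ _ h h' =>
          simp only [map_add, LinearMap.add_apply, h, h']
        | tmul a m b n c p => simp [mul_assoc])
    (fun x p => by
      induction x using tensor₁_induction with
      | add x y hx hy => simp only [map_add, LinearMap.add_apply, hx, hy]
      | tens m n =>
        rw [assoc₁Bilin_tens₁, coactR_tens₁, coactR_tens₁, coactR_tens₁]
        generalize M.coactR m = u
        generalize N.coactR n = w
        generalize P.coactR p = z
        induction u, w, z using ind₃ with
        | add₁ _ _ _ _ h h' | add₂ _ _ _ _ h h' | add₃ _ _ _ _ h h' =>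
          simp only [map_add, LinearMap.add_apply, h, h']
        | tmul a m b n c p => simp [mul_assoc])

/-- The bilinear map `(m, n ⊗₁ p) ↦ (m ⊗₁ n) ⊗₁ p`. -/
def assoc₁InvBilin : M →ₗ[k] tensor₁ N P →ₗ[k] tensor₁ (tensor₁ M N) P where
  toFun m := lift₁ (tens₁ (tensor₁ M N) P ∘ₗ tens₁ M N m)
    fun n a p => tens₁_actR (tensor₁ M N) P (tens₁ M N m n) a p
  map_add' m m' := tensor₁_lin_ext fun n p => by
    change tens₁ (tensor₁ M N) P (tens₁ M N (m + m') n) p =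
      tens₁ (tensor₁ M N) P (tens₁ M N m n) p + tens₁ (tensor₁ M N) P (tens₁ M N m' n) p
    simp only [map_add, LinearMap.add_apply]
  map_smul' c m := tensor₁_lin_ext fun n p => by
    change tens₁ (tensor₁ M N) P (tens₁ M N (c • m) n) p =
      c • tens₁ (tensor₁ M N) P (tens₁ M N m n) p
    simp only [map_smul, LinearMap.smul_apply]

/-- The linear map `M ⊗₁ (N ⊗₁ P) → (M ⊗₁ N) ⊗₁ P`. -/
def assoc₁Inv : tensor₁ M (tensor₁ N P) →ₗ[k] tensor₁ (tensor₁ M N) P :=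
  lift₁ (assoc₁InvBilin M N P) fun m a x => by
    induction x using tensor₁_induction with
    | add x y hx hy => simp only [map_add, hx, hy]
    | tens n p => exact congrArg (fun y => tens₁ (tensor₁ M N) P y p) (tens₁_actR M N m a n)

/-- The associativity isomorphism of `⊗₁`. -/
def assoc₁ : tensor₁ (tensor₁ M N) P ≅ tensor₁ M (tensor₁ N P) :=
  isoOfInverse (assoc₁Hom M N P) (assoc₁Inv M N P)
    (fun x => by
      induction x using tensor₁_induction with
      | add x y hx hy => simp only [map_add, hx, hy]
      | tens x p =>
        induction x using tensor₁_induction with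
        | add x y hx hy => simp only [map_add, LinearMap.add_apply, hx, hy]
        | tens m n => rfl)
    (fun x => by
      induction x using tensor₁_induction with
      | add x y hx hy => simp only [map_add, hx, hy]
      | tens m x =>
        induction x using tensor₁_induction with
        | add x y hx hy => simp only [map_add, hx, hy]
        | tens n p => rfl)

theorem assoc₁_tens₁ (m : M) (n : N) (p : P) :
    lin (assoc₁ M N P).hom (tens₁ (tensor₁ M N) P (tens₁ M N m n) p) =
      tens₁ M (tensor₁ N P) m (tens₁ N P n p) := rfl

/-- The left unit isomorphism of `⊗₁`, induced by the left action. -/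
def leftUnitor₁ : tensor₁ (tautological k A) M ≅ M :=
  isoOfInverse (desc₁ (M := tautological k A) (N := M) M.actL
      (fun a b m => M.mul_actL a b m) (fun a b m => M.mul_actL a b m)
      (fun a m b => (M.actR_actL a m b).symm) (fun a m => M.coactL_actL a m)
      (fun a m => M.coactR_actL a m))
    (tens₁ (tautological k A) M (1 : A))
    (fun x => by
      induction x using tensor₁_induction with
      | add x y hx hy => simp only [map_add, hx, hy]
      | tens a m =>
        refine (tens₁_actR (tautological k A) M (1 : A) a m).symm.trans ?_
        exact congrArg (fun b => tens₁ (tautological k A) M b m) (one_mul (M := A) a))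
    (fun m => M.one_actL m)

theorem leftUnitor₁_tens₁ (a : A) (m : M) :
    lin (leftUnitor₁ M).hom (tens₁ (tautological k A) M a m) = M.actL a m := rfl

/-- The right unit isomorphism of `⊗₁`, induced by the right action. -/
def rightUnitor₁ : tensor₁ M (tautological k A) ≅ M :=
  isoOfInverse (desc₁ (M := M) (N := tautological k A) M.actR
      (fun m a b => (M.actR_mul m a b).symm) (fun a m b => M.actR_actL a m b)
      (fun m a b => M.actR_mul m a b) (fun m a => M.coactL_actR m a)
      (fun m a => M.coactR_actR m a))
    ((tens₁ M (tautological k A)).flip (1 : A))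
    (fun x => by
      induction x using tensor₁_induction with
      | add x y hx hy => simp only [map_add, hx, hy]
      | tens m a =>
        refine (tens₁_actR M (tautological k A) m a (1 : A)).trans ?_
        exact congrArg (tens₁ M (tautological k A) m) (mul_one (M := A) a))
    (fun m => M.actR_one m)

theorem rightUnitor₁_tens₁ (m : M) (a : A) :
    lin (rightUnitor₁ M).hom (tens₁ M (tautological k A) m a) = M.actR m a := rfl

end first

variable (k A) in
/-- The monoidal structure `(⊗₁, A)`. -/
def monoidal₁ : MonoidalStructure (tautological k A) (tensorFunctor₁ k A) where
  α := assoc₁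
  lam := leftUnitor₁
  rho := rightUnitor₁
  α_naturality _ _ _ := hom_ext <| tensor₁_lin_ext₃ fun _ _ _ => rfl
  lam_naturality f := hom_ext <| tensor₁_lin_ext fun a m => (lin_actL f a m).symm
  rho_naturality f := hom_ext <| tensor₁_lin_ext fun m a => (lin_actR f m a).symm
  pentagon _ _ _ _ := hom_ext <| tensor₁_lin_ext₄ fun _ _ _ _ => rfl
  triangle X Y := hom_ext <| tensor₁_lin_ext₃ fun m a n => (tens₁_actR X Y m a n).symm

/-! ### Morphisms into the second tensor product -/

section incl₂

variable (M N : Tetramodule k A)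

theorem linIncl₂_injective : Function.Injective (linIncl₂ M N) :=
  (cotensor M N).injective_subtype

theorem linIncl₂_exact :
    Function.Exact (linIncl₂ M N) (cotensorLeft M N - cotensorRight M N) :=
  cotensor_exact M N

theorem linIncl₂_mem (x : tensor₂ M N) :
    cotensorLeft M N (linIncl₂ M N x) = cotensorRight M N (linIncl₂ M N x) := x.2

theorem mem_range_linIncl₂ {x : M ⊗[k] N} :
    x ∈ LinearMap.range (linIncl₂ M N) ↔ cotensorLeft M N x = cotensorRight M N x :=
  ⟨by rintro ⟨y, rfl⟩; exact linIncl₂_mem M N y, fun h => ⟨⟨x, h⟩, rfl⟩⟩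

theorem linIncl₂_actL (a : A) (x : tensor₂ M N) :
    linIncl₂ M N ((tensor₂ M N).actL a x) = external₂ActL M N a (linIncl₂ M N x) := rfl

theorem linIncl₂_actR (x : tensor₂ M N) (a : A) :
    linIncl₂ M N ((tensor₂ M N).actR x a) = external₂ActR M N (linIncl₂ M N x) a := rfl

theorem linIncl₂_coactL (x : tensor₂ M N) :
    (linIncl₂ M N).lTensor A ((tensor₂ M N).coactL x) =
      external₂CoactL M N (linIncl₂ M N x) :=
  (lin_coactL (incl₂ M N) x).symm

theorem linIncl₂_coactR (x : tensor₂ M N) :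
    (linIncl₂ M N).rTensor A ((tensor₂ M N).coactR x) =
      external₂CoactR M N (linIncl₂ M N x) :=
  (lin_coactR (incl₂ M N) x).symm

variable {M N} {M' N' P : Tetramodule k A}

theorem linIncl₂_tensor₂Map (f : M ⟶ M') (g : N ⟶ N') (x : tensor₂ M N) :
    linIncl₂ M' N' (lin (tensor₂Map f g) x) = map (lin f) (lin g) (linIncl₂ M N x) := rfl

theorem hom_ext₂ {f g : P ⟶ tensor₂ M N}
    (h : ∀ p, linIncl₂ M N (lin f p) = linIncl₂ M N (lin g p)) : f = g :=
  hom_ext (LinearMap.ext fun p => linIncl₂_injective M N (h p))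

theorem cotensorLeft_map (f : M ⟶ M') (g : N ⟶ N') (x : M ⊗[k] N) :
    cotensorLeft M' N' (map (lin f) (lin g) x) =
      map (lin f) ((lin g).lTensor A) (cotensorLeft M N x) := by
  induction x using ind₁ with
  | add _ _ h h' => simp only [map_add, h, h']
  | tmul m n =>
    simp only [map_tmul, cotensorLeft_tmul, lin_coactR]
    generalize M.coactR m = u
    induction u using ind₁ with
    | add _ _ h h' => simp only [map_add, add_tmul, h, h']
    | tmul m a => simp

theorem cotensorRight_map (f : M ⟶ M') (g : N ⟶ N') (x : M ⊗[k] N) :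
    cotensorRight M' N' (map (lin f) (lin g) x) =
      map (lin f) ((lin g).lTensor A) (cotensorRight M N x) := by
  induction x using ind₁ with
  | add _ _ h h' => simp only [map_add, h, h']
  | tmul m n => simp only [map_tmul, cotensorRight_tmul, lin_coactL]

/-- Membership in the cotensor product can be tested after injective morphisms in both factors. -/
theorem cotensor_map_iff (f : M ⟶ M') (g : N ⟶ N') (hf : Function.Injective (lin f))
    (hg : Function.Injective (lin g)) (x : M ⊗[k] N) :
    cotensorLeft M' N' (map (lin f) (lin g) x) = cotensorRight M' N' (map (lin f) (lin g) x) ↔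
      cotensorLeft M N x = cotensorRight M N x := by
  rw [cotensorLeft_map, cotensorRight_map]
  exact (TensorProduct.map_injective_of_flat_flat (lin f) ((lin g).lTensor A) hf
    (Module.Flat.lTensor_preserves_injective_linearMap _ hg)).eq_iff

end incl₂

/-! ### The second monoidal structure -/

section second

variable (M N P : Tetramodule k A)

/-- The associativity morphism of the external product `⊠₂`. -/
def externalAssoc₂ : external₂ (external₂ M N) P ⟶ external₂ M (external₂ N P) :=
  Hom.mk (M := external₂ (external₂ M N) P) (N := external₂ M (external₂ N P))
    (assoc k M N P).toLinearMap
    (fun a (x : (M ⊗[k] N) ⊗[k] P) => by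
      change assoc k M N P (map₂ (map₂ M.actL N.actL ∘ₗ comul) P.actL (comul a) x) =
        map₂ M.actL (map₂ N.actL P.actL ∘ₗ comul) (comul a) (assoc k M N P x)
      trans map₂ M.actL (map₂ N.actL P.actL)
        (assoc k A A A ((comul (R := k) (A := A)).rTensor A (comul a))) (assoc k M N P x)
      · generalize (comul a : A ⊗[k] A) = z
        induction x using ind₁ with
        | add _ _ h h' => simp only [map_add, h, h']
        | tmul y p =>
          induction y, z using ind₂ with
          | addl _ _ _ h h' | addr _ _ _ h h' =>
            simp only [map_add, LinearMap.add_apply, add_tmul, h, h']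
          | tmul m n b c =>
            simp only [map₂_apply_tmul, map_tmul, rTensor_tmul, assoc_tmul, LinearMap.comp_apply]
            generalize (comul b : A ⊗[k] A) = z
            induction z using ind₁ with
            | add _ _ h h' => simp only [map_add, LinearMap.add_apply, add_tmul, h, h']
            | tmul b c => simp
      · rw [Coalgebra.coassoc_apply]
        generalize (comul a : A ⊗[k] A) = z
        generalize assoc k M N P x = y
        induction z, y using ind₂ with
        | addl _ _ _ h h' | addr _ _ _ h h' => simp only [map_add, LinearMap.add_apply, h, h']
        | tmul b c m y => simp)
    (fun (x : (M ⊗[k] N) ⊗[k] P) a => by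
      change assoc k M N P (map₂ ((map₂ M.actR N.actR).compl₂ comul) P.actR x (comul a)) =
        map₂ M.actR ((map₂ N.actR P.actR).compl₂ comul) (assoc k M N P x) (comul a)
      trans map₂ M.actR (map₂ N.actR P.actR) (assoc k M N P x)
        (assoc k A A A ((comul (R := k) (A := A)).rTensor A (comul a)))
      · generalize (comul a : A ⊗[k] A) = z
        induction x using ind₁ with
        | add _ _ h h' => simp only [map_add, LinearMap.add_apply, h, h']
        | tmul y p =>
          induction y, z using ind₂ with
          | addl _ _ _ h h' | addr _ _ _ h h' =>
            simp only [map_add, LinearMap.add_apply, add_tmul, h, h']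
          | tmul m n b c =>
            simp only [map₂_apply_tmul, map_tmul, rTensor_tmul, assoc_tmul,
              LinearMap.compl₂_apply]
            generalize (comul b : A ⊗[k] A) = z
            induction z using ind₁ with
            | add _ _ h h' => simp only [map_add, add_tmul, h, h']
            | tmul b c => simp
      · rw [Coalgebra.coassoc_apply]
        generalize (comul a : A ⊗[k] A) = z
        generalize assoc k M N P x = y
        induction z, y using ind₂ with
        | addl _ _ _ h h' | addr _ _ _ h h' => simp only [map_add, LinearMap.add_apply, h, h']
        | tmul b c m y => simp)
    (fun (x : (M ⊗[k] N) ⊗[k] P) => by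
      change assoc k A M (N ⊗[k] P) (M.coactL.rTensor (N ⊗[k] P) (assoc k M N P x)) =
        (assoc k M N P).toLinearMap.lTensor A (assoc k A (M ⊗[k] N) P
          (((assoc k A M N).toLinearMap ∘ₗ M.coactL.rTensor N).rTensor P x))
      induction x using ind₁ with
      | add _ _ h h' => simp only [map_add, h, h']
      | tmul y p =>
        induction y using ind₁ with
        | add _ _ h h' => simp only [map_add, add_tmul, h, h']
        | tmul m n =>
          simp only [assoc_tmul, rTensor_tmul, LinearMap.comp_apply]
          generalize M.coactL m = u
          induction u using ind₁ with
          | add _ _ h h' => simp only [map_add, add_tmul, h, h']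
          | tmul a m => simp)
    (fun (x : (M ⊗[k] N) ⊗[k] P) => by
      change (assoc k M (N ⊗[k] P) A).symm (((assoc k N P A).symm.toLinearMap ∘ₗ
          P.coactR.lTensor N).lTensor M (assoc k M N P x)) =
        (assoc k M N P).toLinearMap.rTensor A ((assoc k (M ⊗[k] N) P A).symm
          (P.coactR.lTensor (M ⊗[k] N) x))
      induction x using ind₁ with
      | add _ _ h h' => simp only [map_add, h, h']
      | tmul y p =>
        induction y using ind₁ with
        | add _ _ h h' => simp only [map_add, add_tmul, h, h']
        | tmul m n =>
          simp only [assoc_tmul, lTensor_tmul, LinearMap.comp_apply]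
          generalize P.coactR p = u
          induction u using ind₁ with
          | add _ _ h h' => simp only [map_add, tmul_add, h, h']
          | tmul p a => simp)

/-- The inclusion `(M ⊗₂ N) ⊗₂ P ⟶ M ⊠₂ (N ⊠₂ P)`. -/
def inclLeft₂ : tensor₂ (tensor₂ M N) P ⟶ external₂ M (external₂ N P) :=
  incl₂ (tensor₂ M N) P ≫ external₂Map (incl₂ M N) (𝟙 P) ≫ externalAssoc₂ M N P

/-- The inclusion `M ⊗₂ (N ⊗₂ P) ⟶ M ⊠₂ (N ⊠₂ P)`. -/
def inclRight₂ : tensor₂ M (tensor₂ N P) ⟶ external₂ M (external₂ N P) :=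
  incl₂ M (tensor₂ N P) ≫ external₂Map (𝟙 M) (incl₂ N P)

theorem inclLeft₂_injective : Function.Injective (lin (inclLeft₂ M N P)) :=
  (assoc k M N P).injective.comp ((Module.Flat.rTensor_preserves_injective_linearMap _
    (linIncl₂_injective M N)).comp (linIncl₂_injective _ P))

theorem inclRight₂_injective : Function.Injective (lin (inclRight₂ M N P)) :=
  (Module.Flat.lTensor_preserves_injective_linearMap (M := M) _
    (linIncl₂_injective N P)).comp (linIncl₂_injective M _)

theorem mem_range_rTensor_linIncl₂ (v : (M ⊗[k] N) ⊗[k] P) :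
    v ∈ LinearMap.range ((linIncl₂ M N).rTensor P) ↔
      (cotensorLeft M N).rTensor P v = (cotensorRight M N).rTensor P v := by
  refine ((Module.Flat.rTensor_exact P (linIncl₂_exact M N)) v).symm.trans ?_
  rw [LinearMap.rTensor_sub]
  exact sub_eq_zero

theorem mem_range_lTensor_linIncl₂ (w : M ⊗[k] (N ⊗[k] P)) :
    w ∈ LinearMap.range ((linIncl₂ N P).lTensor M) ↔
      (cotensorLeft N P).lTensor M w = (cotensorRight N P).lTensor M w := by
  refine ((Module.Flat.lTensor_exact M (linIncl₂_exact N P)) w).symm.trans ?_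
  rw [LinearMap.lTensor_sub]
  exact sub_eq_zero

/-- The image of `M ⊗₂ (N ⊗₂ P)`: flatness of `M` identifies `M ⊗ (N ⊗₂ P)` with the subspace given
by the second condition. -/
theorem mem_range_inclRight₂ (w : M ⊗[k] (N ⊗[k] P)) :
    w ∈ LinearMap.range (lin (inclRight₂ M N P)) ↔
      cotensorLeft M (external₂ N P) w = cotensorRight M (external₂ N P) w ∧
        (cotensorLeft N P).lTensor M w = (cotensorRight N P).lTensor M w := by
  rw [← mem_range_lTensor_linIncl₂]
  constructor
  · rintro ⟨x, rfl⟩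
    exact ⟨(cotensor_map_iff (𝟙 M) (incl₂ N P) Function.injective_id
      (linIncl₂_injective N P) _).mpr (linIncl₂_mem _ _ x), _, rfl⟩
  · rintro ⟨h, y, rfl⟩
    exact ⟨⟨y, (cotensor_map_iff (𝟙 M) (incl₂ N P) Function.injective_id
      (linIncl₂_injective N P) y).mp h⟩, rfl⟩

/-- The image of `(M ⊗₂ N) ⊗₂ P`: flatness of `P` identifies `(M ⊗₂ N) ⊗ P` with the subspace given
by the second condition. -/
theorem assoc_mem_range_inclLeft₂ (v : (M ⊗[k] N) ⊗[k] P) :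
    assoc k M N P v ∈ LinearMap.range (lin (inclLeft₂ M N P)) ↔
      cotensorLeft (external₂ M N) P v = cotensorRight (external₂ M N) P v ∧
        (cotensorLeft M N).rTensor P v = (cotensorRight M N).rTensor P v := by
  rw [← mem_range_rTensor_linIncl₂]
  constructor
  · rintro ⟨x, hx⟩
    obtain rfl := (assoc k M N P).injective hx
    exact ⟨(cotensor_map_iff (incl₂ M N) (𝟙 P) (linIncl₂_injective M N)
      Function.injective_id _).mpr (linIncl₂_mem _ _ x), _, rfl⟩
  · rintro ⟨h, y, rfl⟩
    exact ⟨⟨y, (cotensor_map_iff (incl₂ M N) (𝟙 P) (linIncl₂_injective M N)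
      Function.injective_id y).mp h⟩, rfl⟩

theorem cotensorLeft_assoc (v : (M ⊗[k] N) ⊗[k] P) :
    cotensorLeft M (external₂ N P) (assoc k M N P v) =
      (assoc k A N P).toLinearMap.lTensor M
        (assoc k M (A ⊗[k] N) P ((cotensorLeft M N).rTensor P v)) := by
  change assoc k M A (N ⊗[k] P) (M.coactR.rTensor (N ⊗[k] P) (assoc k M N P v)) = _
  induction v using ind₁ with
  | add _ _ h h' => simp only [map_add, h, h']
  | tmul y p =>
    induction y using ind₁ with
    | add _ _ h h' => simp only [map_add, add_tmul, h, h']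
    | tmul m n =>
      rw [assoc_tmul, rTensor_tmul, rTensor_tmul, cotensorLeft_tmul]
      generalize M.coactR m = u
      induction u using ind₁ with
      | add _ _ h h' => simp only [map_add, add_tmul, h, h']
      | tmul m a => simp

theorem cotensorRight_assoc (v : (M ⊗[k] N) ⊗[k] P) :
    cotensorRight M (external₂ N P) (assoc k M N P v) =
      (assoc k A N P).toLinearMap.lTensor M
        (assoc k M (A ⊗[k] N) P ((cotensorRight M N).rTensor P v)) := by
  change ((assoc k A N P).toLinearMap ∘ₗ N.coactL.rTensor P).lTensor M (assoc k M N P v) = _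
  induction v using ind₁ with
  | add _ _ h h' => simp only [map_add, h, h']
  | tmul y p =>
    induction y using ind₁ with
    | add _ _ h h' => simp only [map_add, add_tmul, h, h']
    | tmul m n => rfl

theorem lTensor_cotensorLeft_assoc (v : (M ⊗[k] N) ⊗[k] P) :
    (cotensorLeft N P).lTensor M (assoc k M N P v) =
      assoc k M N (A ⊗[k] P) (cotensorLeft (external₂ M N) P v) := by
  change _ = assoc k M N (A ⊗[k] P) (assoc k (M ⊗[k] N) A P
    (((assoc k M N A).symm.toLinearMap ∘ₗ N.coactR.lTensor M).rTensor P v))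
  induction v using ind₁ with
  | add _ _ h h' => simp only [map_add, h, h']
  | tmul y p =>
    induction y using ind₁ with
    | add _ _ h h' => simp only [map_add, add_tmul, h, h']
    | tmul m n =>
      simp only [assoc_tmul, lTensor_tmul, rTensor_tmul, cotensorLeft_tmul,
        LinearMap.comp_apply]
      generalize N.coactR n = u
      induction u using ind₁ with
      | add _ _ h h' => simp only [map_add, add_tmul, tmul_add, h, h']
      | tmul n a => simp

theorem lTensor_cotensorRight_assoc (v : (M ⊗[k] N) ⊗[k] P) :
    (cotensorRight N P).lTensor M (assoc k M N P v) =
      assoc k M N (A ⊗[k] P) (cotensorRight (external₂ M N) P v) := by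
  change _ = assoc k M N (A ⊗[k] P) (P.coactL.lTensor (M ⊗[k] N) v)
  induction v using ind₁ with
  | add _ _ h h' => simp only [map_add, h, h']
  | tmul y p =>
    induction y using ind₁ with
    | add _ _ h h' => simp only [map_add, add_tmul, h, h']
    | tmul m n => rfl

/-- Rebracketing exchanges the two conditions which describe the images of `(M ⊗₂ N) ⊗₂ P` and
`M ⊗₂ (N ⊗₂ P)`. -/
theorem range_inclLeft₂ :
    LinearMap.range (lin (inclLeft₂ M N P)) = LinearMap.range (lin (inclRight₂ M N P)) := by
  ext w
  obtain ⟨v, rfl⟩ := (assoc k M N P).surjective w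
  have hinj : Function.Injective ((assoc k A N P).toLinearMap.lTensor M) :=
    Module.Flat.lTensor_preserves_injective_linearMap _ (assoc k A N P).injective
  refine (assoc_mem_range_inclLeft₂ M N P v).trans
    (Iff.trans ?_ (mem_range_inclRight₂ M N P (assoc k M N P v)).symm)
  rw [cotensorLeft_assoc, cotensorRight_assoc, lTensor_cotensorLeft_assoc,
    lTensor_cotensorRight_assoc]
  exact and_comm.trans (and_congr (hinj.comp (assoc k M (A ⊗[k] N) P).injective).eq_iff.symm
    (assoc k M N (A ⊗[k] P)).injective.eq_iff.symm)

/-- The associativity isomorphism of `⊗₂`. -/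
def assoc₂ : tensor₂ (tensor₂ M N) P ≅ tensor₂ M (tensor₂ N P) :=
  isoOfRangeEq (inclLeft₂ M N P) (inclRight₂ M N P) (inclLeft₂_injective M N P)
    (inclRight₂_injective M N P) (range_inclLeft₂ M N P)

theorem linIncl₂_assoc₂ (x : tensor₂ (tensor₂ M N) P) :
    (linIncl₂ N P).lTensor M (linIncl₂ M (tensor₂ N P) (lin (assoc₂ M N P).hom x)) =
      assoc k M N P ((linIncl₂ M N).rTensor P (linIncl₂ (tensor₂ M N) P x)) :=
  lin_factor (inclLeft₂ M N P) (inclRight₂ M N P) _ _ x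

theorem hom_ext₂_right {X : Tetramodule k A} {f g : X ⟶ tensor₂ M (tensor₂ N P)}
    (h : ∀ x, (linIncl₂ N P).lTensor M (linIncl₂ M (tensor₂ N P) (lin f x)) =
      (linIncl₂ N P).lTensor M (linIncl₂ M (tensor₂ N P) (lin g x))) : f = g :=
  hom_ext (LinearMap.ext fun x => inclRight₂_injective M N P (h x))

/-- The left coaction as a morphism `M ⟶ A ⊠₂ M`. -/
def coactLHom : M ⟶ external₂ (tautological k A) M :=
  Hom.mk (N := external₂ (tautological k A) M) M.coactL M.coactL_actL M.coactL_actR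
    M.coassocL
    (fun m => (LinearEquiv.symm_apply_eq (assoc k A M A)).mpr (M.coactL_coactR m).symm)

/-- The right coaction as a morphism `M ⟶ M ⊠₂ A`. -/
def coactRHom : M ⟶ external₂ M (tautological k A) :=
  Hom.mk (N := external₂ M (tautological k A)) M.coactR M.coactR_actL M.coactR_actR
    M.coactL_coactR
    (fun m => (LinearEquiv.symm_apply_eq (assoc k M A A)).mpr (M.coassocR m).symm)

/-- The map `A ⊗₂ M → M` applying the counit to the first factor. -/
def counitL₂ : tensor₂ (tautological k A) M →ₗ[k] M :=
  (lid k M).toLinearMap ∘ₗ (counit (R := k) (A := A)).rTensor M ∘ₗ linIncl₂ (tautological k A) M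

/-- The map `M ⊗₂ A → M` applying the counit to the second factor. -/
def counitR₂ : tensor₂ M (tautological k A) →ₗ[k] M :=
  (rid k M).toLinearMap ∘ₗ (counit (R := k) (A := A)).lTensor M ∘ₗ linIncl₂ M (tautological k A)

/-- On the cotensor product, the counit is inverse to the coaction: apply the counit to the first
factor of `∑ Δ(aᵢ) ⊗ mᵢ = ∑ aᵢ ⊗ Δ_ℓ(mᵢ)`. -/
theorem coactL_counitL₂ (x : tensor₂ (tautological k A) M) :
    M.coactL (counitL₂ M x) = linIncl₂ (tautological k A) M x := by
  have key (z : A ⊗[k] M) : M.coactL (lid k M ((counit (R := k) (A := A)).rTensor M z)) =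
      lid k (A ⊗[k] M) ((counit (R := k) (A := A)).rTensor (A ⊗[k] M)
        (M.coactL.lTensor A z)) := by
    induction z using ind₁ with
    | add _ _ h h' => simp only [map_add, h, h']
    | tmul a m => simp
  refine (key _).trans (Eq.trans (congrArg (fun z => lid k (A ⊗[k] M)
    ((counit (R := k) (A := A)).rTensor (A ⊗[k] M) z)) ?_)
    (external₂_counitL (tautological k A) M (linIncl₂ (tautological k A) M x)))
  exact (linIncl₂_mem (tautological k A) M x).symm

theorem coactR_counitR₂ (x : tensor₂ M (tautological k A)) :
    M.coactR (counitR₂ M x) = linIncl₂ M (tautological k A) x := by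
  have key (z : M ⊗[k] A) : M.coactR (rid k M ((counit (R := k) (A := A)).lTensor M z)) =
      rid k (M ⊗[k] A) ((counit (R := k) (A := A)).lTensor (M ⊗[k] A)
        (M.coactR.rTensor A z)) := by
    induction z using ind₁ with
    | add _ _ h h' => simp only [map_add, h, h']
    | tmul m a => simp
  refine (key _).trans (Eq.trans (congrArg (fun z => rid k (M ⊗[k] A)
    ((counit (R := k) (A := A)).lTensor (M ⊗[k] A) z)) ?_)
    (external₂_counitR M (tautological k A) (linIncl₂ M (tautological k A) x)))
  exact (LinearEquiv.eq_symm_apply (assoc k M A A)).mpr (linIncl₂_mem M (tautological k A) x)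

/-- The left unit isomorphism of `⊗₂`, inverse to the left coaction. -/
def leftUnitor₂ : tensor₂ (tautological k A) M ≅ M :=
  (isoOfInverse (factor (coactLHom M) (incl₂ (tautological k A) M)
      (linIncl₂_injective (tautological k A) M)
      fun m => (mem_range_linIncl₂ (tautological k A) M).mpr (M.coassocL m))
    (counitL₂ M)
    (fun m => by
      refine Eq.trans (congrArg (fun z => lid k M ((counit (R := k) (A := A)).rTensor M z))
        (lin_factor (coactLHom M) (incl₂ (tautological k A) M) _ _ m)) (M.counitL m))
    (fun x => linIncl₂_injective _ M
      ((lin_factor (coactLHom M) (incl₂ (tautological k A) M) _ _ _).trans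
        (coactL_counitL₂ M x)))).symm

/-- The right unit isomorphism of `⊗₂`, inverse to the right coaction. -/
def rightUnitor₂ : tensor₂ M (tautological k A) ≅ M :=
  (isoOfInverse (factor (coactRHom M) (incl₂ M (tautological k A))
      (linIncl₂_injective M (tautological k A))
      fun m => (mem_range_linIncl₂ M (tautological k A)).mpr (M.coassocR m))
    (counitR₂ M)
    (fun m => by
      refine Eq.trans (congrArg (fun z => rid k M ((counit (R := k) (A := A)).lTensor M z))
        (lin_factor (coactRHom M) (incl₂ M (tautological k A)) _ _ m)) (M.counitR m))
    (fun x => linIncl₂_injective M _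
      ((lin_factor (coactRHom M) (incl₂ M (tautological k A)) _ _ _).trans
        (coactR_counitR₂ M x)))).symm

theorem linIncl₂_leftUnitor₂_inv (m : M) :
    linIncl₂ (tautological k A) M (lin (leftUnitor₂ M).inv m) = M.coactL m :=
  lin_factor (coactLHom M) (incl₂ (tautological k A) M) _ _ m

theorem linIncl₂_rightUnitor₂_inv (m : M) :
    linIncl₂ M (tautological k A) (lin (rightUnitor₂ M).inv m) = M.coactR m :=
  lin_factor (coactRHom M) (incl₂ M (tautological k A)) _ _ m

theorem leftUnitor₂_apply (x : tensor₂ (tautological k A) M) : lin (leftUnitor₂ M).hom x =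
    lid k M ((counit (R := k) (A := A)).rTensor M (linIncl₂ (tautological k A) M x)) := rfl

theorem rightUnitor₂_apply (x : tensor₂ M (tautological k A)) : lin (rightUnitor₂ M).hom x =
    rid k M ((counit (R := k) (A := A)).lTensor M (linIncl₂ M (tautological k A) x)) := rfl

end second

section coherence₂

variable {M N P Q M' N' P' : Tetramodule k A}

theorem assoc₂_naturality (f : M ⟶ M') (g : N ⟶ N') (h : P ⟶ P') :
    tensor₂Map (tensor₂Map f g) h ≫ (assoc₂ M' N' P').hom =
      (assoc₂ M N P).hom ≫ tensor₂Map f (tensor₂Map g h) := by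
  refine hom_ext₂_right M' N' P' fun x => ?_
  have hl (z : tensor₂ M N ⊗[k] P) : (linIncl₂ M' N').rTensor P'
      (map (lin (tensor₂Map f g)) (lin h) z) =
      map (map (lin f) (lin g)) (lin h) ((linIncl₂ M N).rTensor P z) := by
    induction z using ind₁ with
    | add _ _ h h' => simp only [map_add, h, h']
    | tmul x p => simp only [map_tmul, rTensor_tmul, linIncl₂_tensor₂Map]
  have hr (z : M ⊗[k] tensor₂ N P) : (linIncl₂ N' P').lTensor M'
      (map (lin f) (lin (tensor₂Map g h)) z) =
      map (lin f) (map (lin g) (lin h)) ((linIncl₂ N P).lTensor M z) := by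
    induction z using ind₁ with
    | add _ _ h h' => simp only [map_add, h, h']
    | tmul m x => simp only [map_tmul, lTensor_tmul, linIncl₂_tensor₂Map]
  simp only [lin_comp, LinearMap.comp_apply]
  rw [linIncl₂_assoc₂, linIncl₂_tensor₂Map, linIncl₂_tensor₂Map, hl, hr, linIncl₂_assoc₂]
  generalize (linIncl₂ M N).rTensor P (linIncl₂ (tensor₂ M N) P x) = z
  induction z using ind₁ with
  | add _ _ h h' => simp only [map_add, h, h']
  | tmul y p =>
    induction y using ind₁ with
    | add _ _ h h' => simp only [map_add, add_tmul, h, h']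
    | tmul m n => simp

theorem lTensor_rTensor_assoc {V V' W X : Type*} [AddCommGroup V] [AddCommGroup V']
    [AddCommGroup W] [AddCommGroup X] [Module k V] [Module k V'] [Module k W] [Module k X]
    (f : V →ₗ[k] V') (z : (W ⊗[k] V) ⊗[k] X) :
    (f.rTensor X).lTensor W (assoc k W V X z) = assoc k W V' X ((f.lTensor W).rTensor X z) := by
  induction z using ind₁ with
  | add _ _ h h' => simp only [map_add, h, h']
  | tmul y x =>
    induction y using ind₁ with
    | add _ _ h h' => simp only [map_add, add_tmul, h, h']
    | tmul w v => simp

theorem lTensor_lTensor_assoc {V V' W X : Type*} [AddCommGroup V] [AddCommGroup V']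
    [AddCommGroup W] [AddCommGroup X] [Module k V] [Module k V'] [Module k W] [Module k X]
    (f : V →ₗ[k] V') (z : (W ⊗[k] X) ⊗[k] V) :
    (f.lTensor X).lTensor W (assoc k W X V z) = assoc k W X V' (f.lTensor (W ⊗[k] X) z) := by
  induction z using ind₁ with
  | add _ _ h h' => simp only [map_add, h, h']
  | tmul y x =>
    induction y using ind₁ with
    | add _ _ h h' => simp only [map_add, add_tmul, h, h']
    | tmul w v => simp

theorem rTensor_assoc {V V' W X : Type*} [AddCommGroup V] [AddCommGroup V']
    [AddCommGroup W] [AddCommGroup X] [Module k V] [Module k V'] [Module k W] [Module k X]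
    (f : V →ₗ[k] V') (z : (V ⊗[k] W) ⊗[k] X) :
    f.rTensor (W ⊗[k] X) (assoc k V W X z) = assoc k V' W X ((f.rTensor W).rTensor X z) := by
  induction z using ind₁ with
  | add _ _ h h' => simp only [map_add, h, h']
  | tmul y x =>
    induction y using ind₁ with
    | add _ _ h h' => simp only [map_add, add_tmul, h, h']
    | tmul w v => simp

theorem pentagon₂ (L M N P : Tetramodule k A) :
    tensor₂Map (assoc₂ L M N).hom (𝟙 P) ≫ (assoc₂ L (tensor₂ M N) P).hom ≫
        tensor₂Map (𝟙 L) (assoc₂ M N P).hom =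
      (assoc₂ (tensor₂ L M) N P).hom ≫ (assoc₂ L M (tensor₂ N P)).hom := by
  refine hom_ext₂_right L M (tensor₂ N P) fun x => ?_
  -- Both sides are compared after the inclusion into `L ⊗ (M ⊗ (N ⊗ P))`.
  have hinj : Function.Injective (((linIncl₂ N P).lTensor M).lTensor L) :=
    Module.Flat.lTensor_preserves_injective_linearMap _
      (Module.Flat.lTensor_preserves_injective_linearMap _ (linIncl₂_injective N P))
  apply hinj
  have hr (z : L ⊗[k] tensor₂ (tensor₂ M N) P) :
      ((linIncl₂ N P).lTensor M).lTensor L ((linIncl₂ M (tensor₂ N P)).lTensor L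
        (map (lin (𝟙 L)) (lin (assoc₂ M N P).hom) z)) =
      (assoc k M N P).toLinearMap.lTensor L (((linIncl₂ M N).rTensor P).lTensor L
        ((linIncl₂ (tensor₂ M N) P).lTensor L z)) := by
    induction z using ind₁ with
    | add _ _ h h' => simp only [map_add, h, h']
    | tmul l y =>
      simp only [map_tmul, lTensor_tmul, linIncl₂_assoc₂]
      rfl
  have hl (z : tensor₂ (tensor₂ L M) N ⊗[k] P) :
      ((linIncl₂ M N).lTensor L).rTensor P ((linIncl₂ L (tensor₂ M N)).rTensor P
        (map (lin (assoc₂ L M N).hom) (lin (𝟙 P)) z)) =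
      (assoc k L M N).toLinearMap.rTensor P (((linIncl₂ L M).rTensor N).rTensor P
        ((linIncl₂ (tensor₂ L M) N).rTensor P z)) := by
    induction z using ind₁ with
    | add _ _ h h' => simp only [map_add, h, h']
    | tmul y p =>
      simp only [map_tmul, rTensor_tmul, linIncl₂_assoc₂]
      rfl
  have hc (z : tensor₂ L M ⊗[k] tensor₂ N P) :
      (linIncl₂ N P).lTensor (L ⊗[k] M) ((linIncl₂ L M).rTensor (tensor₂ N P) z) =
        (linIncl₂ L M).rTensor (N ⊗[k] P) ((linIncl₂ N P).lTensor (tensor₂ L M) z) := by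
    induction z using ind₁ with
    | add _ _ h h' => simp only [map_add, h, h']
    | tmul y z => rfl
  simp only [lin_comp, LinearMap.comp_apply]
  rw [linIncl₂_tensor₂Map, hr, linIncl₂_assoc₂, lTensor_rTensor_assoc, linIncl₂_tensor₂Map, hl,
    linIncl₂_assoc₂, lTensor_lTensor_assoc, hc, linIncl₂_assoc₂, rTensor_assoc]
  generalize ((linIncl₂ L M).rTensor N).rTensor P ((linIncl₂ (tensor₂ L M) N).rTensor P
    (linIncl₂ (tensor₂ (tensor₂ L M) N) P x)) = z
  induction z using ind₁ with
  | add _ _ h h' => simp only [map_add, h, h']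
  | tmul y p =>
    induction y using ind₁ with
    | add _ _ h h' => simp only [map_add, add_tmul, h, h']
    | tmul y n =>
      induction y using ind₁ with
      | add _ _ h h' => simp only [map_add, add_tmul, h, h']
      | tmul l m => simp

theorem triangle₂ (M N : Tetramodule k A) :
    (assoc₂ M (tautological k A) N).hom ≫ tensor₂Map (𝟙 M) (leftUnitor₂ N).hom =
      tensor₂Map (rightUnitor₂ M).hom (𝟙 N) := by
  refine hom_ext₂ fun x => ?_
  have hr (z : M ⊗[k] tensor₂ (tautological k A) N) :
      map (lin (𝟙 M)) (lin (leftUnitor₂ N).hom) z =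
        ((lid k N).toLinearMap ∘ₗ (counit (R := k) (A := A)).rTensor N).lTensor M
          ((linIncl₂ (tautological k A) N).lTensor M z) :=
    DFunLike.congr_fun (LinearMap.lTensor_comp M ((lid k N).toLinearMap ∘ₗ
      (counit (R := k) (A := A)).rTensor N) (linIncl₂ (tautological k A) N)) z
  have hl (z : tensor₂ M (tautological k A) ⊗[k] N) :
      map (lin (rightUnitor₂ M).hom) (lin (𝟙 N)) z =
        ((rid k M).toLinearMap ∘ₗ (counit (R := k) (A := A)).lTensor M).rTensor N
          ((linIncl₂ M (tautological k A)).rTensor N z) :=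
    DFunLike.congr_fun (LinearMap.rTensor_comp N ((rid k M).toLinearMap ∘ₗ
      (counit (R := k) (A := A)).lTensor M) (linIncl₂ M (tautological k A))) z
  have key (z : (M ⊗[k] A) ⊗[k] N) :
      ((lid k N).toLinearMap ∘ₗ (counit (R := k) (A := A)).rTensor N).lTensor M
        (assoc k M A N z) =
      ((rid k M).toLinearMap ∘ₗ (counit (R := k) (A := A)).lTensor M).rTensor N z := by
    induction z using ind₁ with
    | add _ _ h h' => simp only [map_add, h, h']
    | tmul y n =>
      induction y using ind₁ with
      | add _ _ h h' => simp only [map_add, add_tmul, h, h']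
      | tmul m a => simp [TensorProduct.smul_tmul]
  simp only [lin_comp, LinearMap.comp_apply]
  rw [linIncl₂_tensor₂Map, linIncl₂_tensor₂Map, hr, hl]
  exact (congrArg _ (linIncl₂_assoc₂ M (tautological k A) N x)).trans (key _)

variable (k A) in
/-- The monoidal structure `(⊗₂, A)`. -/
def monoidal₂ : MonoidalStructure (tautological k A) (tensorFunctor₂ k A) where
  α := assoc₂
  lam := leftUnitor₂
  rho := rightUnitor₂
  α_naturality := assoc₂_naturality
  lam_naturality {X _} f := hom_ext <| LinearMap.ext fun x =>
    nat_counitL (A := A) (lin f) (linIncl₂ (tautological k A) X x)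
  rho_naturality {X _} f := hom_ext <| LinearMap.ext fun x =>
    nat_counitR (A := A) (lin f) (linIncl₂ X (tautological k A) x)
  pentagon := pentagon₂
  triangle := triangle₂

end coherence₂

/-! ### The interchange morphism -/

section interchange

variable (M N P Q : Tetramodule k A)

theorem cotensorLeft_map₂_tens₁ (x : M ⊗[k] N) (y : P ⊗[k] Q) :
    cotensorLeft (tensor₁ M P) (tensor₁ N Q) (map₂ (tens₁ M P) (tens₁ N Q) x y) =
      map₂ (tens₁ M P) (map₂ (LinearMap.mul k A) (tens₁ N Q))
        (cotensorLeft M N x) (cotensorLeft P Q y) := by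
  induction x, y using ind₂ with
  | addl _ _ _ h h' | addr _ _ _ h h' => simp only [map_add, LinearMap.add_apply, h, h']
  | tmul m n p q =>
    simp only [map₂_apply_tmul, map_tmul, cotensorLeft_tmul, coactR_tens₁]
    generalize M.coactR m = u
    generalize P.coactR p = w
    induction u, w using ind₂ with
    | addl _ _ _ h h' | addr _ _ _ h h' =>
      simp only [map_add, LinearMap.add_apply, add_tmul, h, h']
    | tmul m a p b => simp

theorem cotensorRight_map₂_tens₁ (x : M ⊗[k] N) (y : P ⊗[k] Q) :
    cotensorRight (tensor₁ M P) (tensor₁ N Q) (map₂ (tens₁ M P) (tens₁ N Q) x y) =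
      map₂ (tens₁ M P) (map₂ (LinearMap.mul k A) (tens₁ N Q))
        (cotensorRight M N x) (cotensorRight P Q y) := by
  induction x, y using ind₂ with
  | addl _ _ _ h h' | addr _ _ _ h h' => simp only [map_add, LinearMap.add_apply, h, h']
  | tmul m n p q => simp only [map₂_apply_tmul, map_tmul, cotensorRight_tmul, coactL_tens₁]

/-- The bilinear map `(M ⊗₂ N) × (P ⊗₂ Q) → (M ⊗₁ P) ⊗₂ (N ⊗₁ Q)` which swaps the two middle
factors. -/
def interchangeBilin :
    tensor₂ M N →ₗ[k] tensor₂ P Q →ₗ[k] tensor₂ (tensor₁ M P) (tensor₁ N Q) :=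
  LinearMap.codRestrict₂ ((map₂ (tens₁ M P) (tens₁ N Q)).compl₁₂ (linIncl₂ M N) (linIncl₂ P Q))
    (linIncl₂ (tensor₁ M P) (tensor₁ N Q)) (linIncl₂_injective _ _) fun x y => by
      rw [mem_range_linIncl₂, LinearMap.compl₁₂_apply, cotensorLeft_map₂_tens₁,
        cotensorRight_map₂_tens₁, linIncl₂_mem, linIncl₂_mem]

theorem linIncl₂_interchangeBilin (x : tensor₂ M N) (y : tensor₂ P Q) :
    linIncl₂ (tensor₁ M P) (tensor₁ N Q) (interchangeBilin M N P Q x y) =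
      map₂ (tens₁ M P) (tens₁ N Q) (linIncl₂ M N x) (linIncl₂ P Q y) :=
  LinearMap.codRestrict₂_apply _ _ _ _ x y

/-- The interchange morphism `(M ⊗₂ N) ⊗₁ (P ⊗₂ Q) ⟶ (M ⊗₁ P) ⊗₂ (N ⊗₁ Q)`. -/
def interchange :
    tensor₁ (tensor₂ M N) (tensor₂ P Q) ⟶ tensor₂ (tensor₁ M P) (tensor₁ N Q) :=
  desc₁ (interchangeBilin M N P Q)
    (fun x a y => by
      apply linIncl₂_injective
      rw [linIncl₂_interchangeBilin, linIncl₂_interchangeBilin, linIncl₂_actR, linIncl₂_actL,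
        external₂ActR_apply, external₂ActL_apply]
      generalize (comul a : A ⊗[k] A) = z
      generalize linIncl₂ M N x = u
      generalize linIncl₂ P Q y = w
      induction z, u, w using ind₃ with
      | add₁ _ _ _ _ h h' | add₂ _ _ _ _ h h' | add₃ _ _ _ _ h h' =>
        simp only [map_add, LinearMap.add_apply, h, h']
      | tmul a b m n p q => simp [tens₁_actR])
    (fun a x y => by
      apply linIncl₂_injective
      rw [linIncl₂_actL, linIncl₂_interchangeBilin, linIncl₂_interchangeBilin, linIncl₂_actL,
        external₂ActL_apply, external₂ActL_apply]
      generalize (comul a : A ⊗[k] A) = z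
      generalize linIncl₂ M N x = u
      generalize linIncl₂ P Q y = w
      induction z, u, w using ind₃ with
      | add₁ _ _ _ _ h h' | add₂ _ _ _ _ h h' | add₃ _ _ _ _ h h' =>
        simp only [map_add, LinearMap.add_apply, h, h']
      | tmul a b m n p q => simp [actL_tens₁])
    (fun x y a => by
      apply linIncl₂_injective
      rw [linIncl₂_actR, linIncl₂_interchangeBilin, linIncl₂_interchangeBilin, linIncl₂_actR,
        external₂ActR_apply, external₂ActR_apply]
      generalize (comul a : A ⊗[k] A) = z
      generalize linIncl₂ M N x = u
      generalize linIncl₂ P Q y = w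
      induction z, u, w using ind₃ with
      | add₁ _ _ _ _ h h' | add₂ _ _ _ _ h h' | add₃ _ _ _ _ h h' =>
        simp only [map_add, LinearMap.add_apply, h, h']
      | tmul a b m n p q => simp [actR_tens₁])
    (fun x y => by
      apply Module.Flat.lTensor_preserves_injective_linearMap (M := A) _
        (linIncl₂_injective (tensor₁ M P) (tensor₁ N Q))
      have h (u : A ⊗[k] tensor₂ M N) (w : A ⊗[k] tensor₂ P Q) :
          (linIncl₂ (tensor₁ M P) (tensor₁ N Q)).lTensor A
            (map₂ (LinearMap.mul k A) (interchangeBilin M N P Q) u w) =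
          map₂ (LinearMap.mul k A) (map₂ (tens₁ M P) (tens₁ N Q))
            ((linIncl₂ M N).lTensor A u) ((linIncl₂ P Q).lTensor A w) := by
        induction u, w using ind₂ with
        | addl _ _ _ h h' | addr _ _ _ h h' => simp only [map_add, LinearMap.add_apply, h, h']
        | tmul a x b y =>
          simp only [map₂_apply_tmul, map_tmul, lTensor_tmul, linIncl₂_interchangeBilin]
      rw [linIncl₂_coactL, linIncl₂_interchangeBilin, h, linIncl₂_coactL, linIncl₂_coactL]
      generalize linIncl₂ M N x = u
      generalize linIncl₂ P Q y = w
      induction u, w using ind₂ with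
      | addl _ _ _ h h' | addr _ _ _ h h' => simp only [map_add, LinearMap.add_apply, h, h']
      | tmul m n p q =>
        simp only [map₂_apply_tmul, map_tmul, external₂CoactL_tmul, coactL_tens₁]
        generalize M.coactL m = u
        generalize P.coactL p = w
        induction u, w using ind₂ with
        | addl _ _ _ h h' | addr _ _ _ h h' =>
          simp only [map_add, LinearMap.add_apply, add_tmul, h, h']
        | tmul a m b p => simp)
    (fun x y => by
      apply Module.Flat.rTensor_preserves_injective_linearMap (M := A) _
        (linIncl₂_injective (tensor₁ M P) (tensor₁ N Q))
      have h (u : tensor₂ M N ⊗[k] A) (w : tensor₂ P Q ⊗[k] A) :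
          (linIncl₂ (tensor₁ M P) (tensor₁ N Q)).rTensor A
            (map₂ (interchangeBilin M N P Q) (LinearMap.mul k A) u w) =
          map₂ (map₂ (tens₁ M P) (tens₁ N Q)) (LinearMap.mul k A)
            ((linIncl₂ M N).rTensor A u) ((linIncl₂ P Q).rTensor A w) := by
        induction u, w using ind₂ with
        | addl _ _ _ h h' | addr _ _ _ h h' => simp only [map_add, LinearMap.add_apply, h, h']
        | tmul a x b y =>
          simp only [map₂_apply_tmul, map_tmul, rTensor_tmul, linIncl₂_interchangeBilin]
      rw [linIncl₂_coactR, linIncl₂_interchangeBilin, h, linIncl₂_coactR, linIncl₂_coactR]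
      generalize linIncl₂ M N x = u
      generalize linIncl₂ P Q y = w
      induction u, w using ind₂ with
      | addl _ _ _ h h' | addr _ _ _ h h' => simp only [map_add, LinearMap.add_apply, h, h']
      | tmul m n p q =>
        simp only [map₂_apply_tmul, map_tmul, external₂CoactR_tmul, coactR_tens₁]
        generalize N.coactR n = u
        generalize Q.coactR q = w
        induction u, w using ind₂ with
        | addl _ _ _ h h' | addr _ _ _ h h' =>
          simp only [map_add, LinearMap.add_apply, tmul_add, h, h']
        | tmul n a q b => simp)

theorem linIncl₂_interchange (x : tensor₂ M N) (y : tensor₂ P Q) :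
    linIncl₂ (tensor₁ M P) (tensor₁ N Q)
        (lin (interchange M N P Q) (tens₁ (tensor₂ M N) (tensor₂ P Q) x y)) =
      map₂ (tens₁ M P) (tens₁ N Q) (linIncl₂ M N x) (linIncl₂ P Q y) :=
  linIncl₂_interchangeBilin M N P Q x y

end interchange

/-! ### Coherence of the interchange morphism -/

section interchange_coherence

theorem hom_ext₁ {M N P : Tetramodule k A} {f g : tensor₁ M N ⟶ P}
    (h : ∀ m n, lin f (tens₁ M N m n) = lin g (tens₁ M N m n)) : f = g :=
  hom_ext (tensor₁_lin_ext h)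

theorem map_map₂ {V V' W W' X X' Y Y' : Type*} [AddCommGroup V] [AddCommGroup V'] [AddCommGroup W]
    [AddCommGroup W'] [AddCommGroup X] [AddCommGroup X'] [AddCommGroup Y] [AddCommGroup Y']
    [Module k V] [Module k V'] [Module k W] [Module k W'] [Module k X] [Module k X'] [Module k Y]
    [Module k Y'] (p : X →ₗ[k] Y) (q : X' →ₗ[k] Y') (f : V →ₗ[k] W →ₗ[k] X)
    (g : V' →ₗ[k] W' →ₗ[k] X') (u : V ⊗[k] V') (w : W ⊗[k] W') :
    map p q (map₂ f g u w) = map₂ (f.compr₂ p) (g.compr₂ q) u w := by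
  induction u, w using ind₂ with
  | addl _ _ _ h h' | addr _ _ _ h h' => simp only [map_add, LinearMap.add_apply, h, h']
  | tmul a b c d => rfl

theorem interchange_naturality {M N P Q M' N' P' Q' : Tetramodule k A}
    (f : M ⟶ M') (g : N ⟶ N') (h : P ⟶ P') (l : Q ⟶ Q') :
    tensor₁Map (tensor₂Map f g) (tensor₂Map h l) ≫ interchange M' N' P' Q' =
      interchange M N P Q ≫ tensor₂Map (tensor₁Map f h) (tensor₁Map g l) := by
  refine hom_ext₁ fun x y => linIncl₂_injective _ _ ?_
  simp only [lin_comp, LinearMap.comp_apply]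
  rw [tensor₁Map_tens₁, linIncl₂_interchange, linIncl₂_tensor₂Map, linIncl₂_tensor₂Map,
    linIncl₂_tensor₂Map, linIncl₂_interchange]
  generalize linIncl₂ M N x = u
  generalize linIncl₂ P Q y = w
  induction u, w using ind₂ with
  | addl _ _ _ h h' | addr _ _ _ h h' => simp only [map_add, LinearMap.add_apply, h, h']
  | tmul m n p q => simp [tensor₁Map_tens₁]

theorem interchange_internal_assoc (U V W X Y Z : Tetramodule k A) :
    tensor₁Map (interchange U V W X) (𝟙 (tensor₂ Y Z)) ≫
        interchange (tensor₁ U W) (tensor₁ V X) Y Z ≫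
          tensor₂Map (assoc₁ U W Y).hom (assoc₁ V X Z).hom =
      (assoc₁ (tensor₂ U V) (tensor₂ W X) (tensor₂ Y Z)).hom ≫
        tensor₁Map (𝟙 (tensor₂ U V)) (interchange W X Y Z) ≫
          interchange U V (tensor₁ W Y) (tensor₁ X Z) := by
  refine hom_ext (tensor₁_lin_ext₃ fun x y z => linIncl₂_injective _ _ ?_)
  simp only [lin_comp, LinearMap.comp_apply]
  rw [assoc₁_tens₁, tensor₁Map_tens₁, tensor₁Map_tens₁, linIncl₂_tensor₂Map,
    linIncl₂_interchange, linIncl₂_interchange, linIncl₂_interchange, linIncl₂_interchange]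
  simp only [lin_id, LinearMap.id_apply]
  generalize linIncl₂ U V x = u
  generalize linIncl₂ W X y = v
  generalize linIncl₂ Y Z z = w
  induction u, v, w using ind₃ with
  | add₁ _ _ _ _ h h' | add₂ _ _ _ _ h h' | add₃ _ _ _ _ h h' =>
    simp only [map_add, LinearMap.add_apply, h, h']
  | tmul a b c d e f => simp [assoc₁_tens₁]

theorem interchange_external_assoc (U V W X Y Z : Tetramodule k A) :
    interchange (tensor₂ U V) W (tensor₂ X Y) Z ≫
        tensor₂Map (interchange U V X Y) (𝟙 (tensor₁ W Z)) ≫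
          (assoc₂ (tensor₁ U X) (tensor₁ V Y) (tensor₁ W Z)).hom =
      tensor₁Map (assoc₂ U V W).hom (assoc₂ X Y Z).hom ≫
        interchange U (tensor₂ V W) X (tensor₂ Y Z) ≫
          tensor₂Map (𝟙 (tensor₁ U X)) (interchange V W Y Z) := by
  refine hom_ext₁ fun x y => inclRight₂_injective (tensor₁ U X) (tensor₁ V Y) (tensor₁ W Z) ?_
  change (linIncl₂ (tensor₁ V Y) (tensor₁ W Z)).lTensor (tensor₁ U X) (linIncl₂ _ _ _) =
    (linIncl₂ (tensor₁ V Y) (tensor₁ W Z)).lTensor (tensor₁ U X) (linIncl₂ _ _ _)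
  simp only [lin_comp, LinearMap.comp_apply]
  -- Both sides depend only on the images of `x` and `y` in the threefold tensor products over `k`.
  have hl (s : tensor₂ U V ⊗[k] W) (t : tensor₂ X Y ⊗[k] Z) :
      (linIncl₂ (tensor₁ U X) (tensor₁ V Y)).rTensor (tensor₁ W Z)
        (map (lin (interchange U V X Y)) (lin (𝟙 (tensor₁ W Z)))
          (map₂ (tens₁ (tensor₂ U V) (tensor₂ X Y)) (tens₁ W Z) s t)) =
      map₂ (map₂ (tens₁ U X) (tens₁ V Y)) (tens₁ W Z)
        ((linIncl₂ U V).rTensor W s) ((linIncl₂ X Y).rTensor Z t) := by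
    induction s, t using ind₂ with
    | addl _ _ _ h h' | addr _ _ _ h h' => simp only [map_add, LinearMap.add_apply, h, h']
    | tmul a w b z =>
      simp only [map₂_apply_tmul, map_tmul, rTensor_tmul, linIncl₂_interchange, lin_id,
        LinearMap.id_apply]
  have hr (s : U ⊗[k] tensor₂ V W) (t : X ⊗[k] tensor₂ Y Z) :
      (linIncl₂ (tensor₁ V Y) (tensor₁ W Z)).lTensor (tensor₁ U X)
        (map (lin (𝟙 (tensor₁ U X))) (lin (interchange V W Y Z))
          (map₂ (tens₁ U X) (tens₁ (tensor₂ V W) (tensor₂ Y Z)) s t)) =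
      map₂ (tens₁ U X) (map₂ (tens₁ V Y) (tens₁ W Z))
        ((linIncl₂ V W).lTensor U s) ((linIncl₂ Y Z).lTensor X t) := by
    induction s, t using ind₂ with
    | addl _ _ _ h h' | addr _ _ _ h h' => simp only [map_add, LinearMap.add_apply, h, h']
    | tmul u a x b =>
      simp only [map₂_apply_tmul, map_tmul, lTensor_tmul, linIncl₂_interchange, lin_id,
        LinearMap.id_apply]
  rw [linIncl₂_assoc₂, linIncl₂_tensor₂Map, linIncl₂_interchange, hl, linIncl₂_tensor₂Map,
    tensor₁Map_tens₁, linIncl₂_interchange, hr, linIncl₂_assoc₂, linIncl₂_assoc₂]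
  generalize (linIncl₂ U V).rTensor W (linIncl₂ (tensor₂ U V) W x) = s
  generalize (linIncl₂ X Y).rTensor Z (linIncl₂ (tensor₂ X Y) Z y) = t
  induction s, t using ind₂ with
  | addl _ _ _ h h' | addr _ _ _ h h' => simp only [map_add, LinearMap.add_apply, h, h']
  | tmul s w t z =>
    induction s, t using ind₂ with
    | addl _ _ _ h h' | addr _ _ _ h h' =>
      simp only [map_add, LinearMap.add_apply, add_tmul, h, h']
    | tmul u v x y => simp

/-- The unit isomorphism `A ⊗₂ A → A` is inverse to the coproduct. This turns the diagonal actions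
of `A` on `M ⊗₂ N` into factorwise actions of `A ⊗₂ A`. -/
theorem comul_leftUnitor₂ (x : tensor₂ (tautological k A) (tautological k A)) :
    comul (R := k) (A := A) (lin (leftUnitor₂ (tautological k A)).hom x) =
      linIncl₂ (tautological k A) (tautological k A) x :=
  coactL_counitL₂ (tautological k A) x

theorem interchange_internal_unit_right (M N : Tetramodule k A) :
    interchange M N (tautological k A) (tautological k A) ≫
        tensor₂Map (rightUnitor₁ M).hom (rightUnitor₁ N).hom =
      tensor₁Map (𝟙 (tensor₂ M N)) (leftUnitor₂ (tautological k A)).hom ≫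
        (rightUnitor₁ (tensor₂ M N)).hom := by
  refine hom_ext₁ fun x y => linIncl₂_injective _ _ ?_
  simp only [lin_comp, LinearMap.comp_apply]
  rw [tensor₁Map_tens₁, linIncl₂_tensor₂Map, linIncl₂_interchange]
  -- The right action on `M ⊗₂ N` is the factorwise right action of `Δ(a)`.
  refine Eq.trans ?_ (congrArg (map₂ M.actR N.actR (linIncl₂ M N x))
    (comul_leftUnitor₂ y)).symm
  exact map_map₂ _ _ _ _ _ _

theorem interchange_internal_unit_left (M N : Tetramodule k A) :
    interchange (tautological k A) (tautological k A) M N ≫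
        tensor₂Map (leftUnitor₁ M).hom (leftUnitor₁ N).hom =
      tensor₁Map (leftUnitor₂ (tautological k A)).hom (𝟙 (tensor₂ M N)) ≫
        (leftUnitor₁ (tensor₂ M N)).hom := by
  refine hom_ext₁ fun y x => linIncl₂_injective _ _ ?_
  simp only [lin_comp, LinearMap.comp_apply]
  rw [tensor₁Map_tens₁, linIncl₂_tensor₂Map, linIncl₂_interchange]
  refine Eq.trans ?_ (congrArg (fun z => map₂ M.actL N.actL z (linIncl₂ M N x))
    (comul_leftUnitor₂ y)).symm
  exact map_map₂ _ _ _ _ _ _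

theorem interchange_external_unit_right (M N : Tetramodule k A) :
    interchange M (tautological k A) N (tautological k A) ≫
        tensor₂Map (𝟙 (tensor₁ M N)) (leftUnitor₁ (tautological k A)).hom ≫
          (rightUnitor₂ (tensor₁ M N)).hom =
      tensor₁Map (rightUnitor₂ M).hom (rightUnitor₂ N).hom := by
  refine hom_ext₁ fun x y => ?_
  simp only [lin_comp, LinearMap.comp_apply]
  rw [tensor₁Map_tens₁, rightUnitor₂_apply, rightUnitor₂_apply, rightUnitor₂_apply,
    linIncl₂_tensor₂Map, linIncl₂_interchange]
  -- The counit is multiplicative.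
  have key (u : M ⊗[k] A) (w : N ⊗[k] A) : rid k (tensor₁ M N)
      ((counit (R := k) (A := A)).lTensor (tensor₁ M N)
        (map₂ (tens₁ M N) (LinearMap.mul k A) u w)) =
      tens₁ M N (rid k M ((counit (R := k) (A := A)).lTensor M u))
        (rid k N ((counit (R := k) (A := A)).lTensor N w)) := by
    induction u, w using ind₂ with
    | addl _ _ _ h h' | addr _ _ _ h h' => simp only [map_add, LinearMap.add_apply, h, h']
    | tmul m a n b => simp [smul_smul, mul_comm]
  refine Eq.trans (congrArg (fun z => rid k (tensor₁ M N)
    ((counit (R := k) (A := A)).lTensor (tensor₁ M N) z)) ?_) (key _ _)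
  exact map_map₂ _ _ _ _ _ _

theorem interchange_external_unit_left (M N : Tetramodule k A) :
    interchange (tautological k A) M (tautological k A) N ≫
        tensor₂Map (leftUnitor₁ (tautological k A)).hom (𝟙 (tensor₁ M N)) ≫
          (leftUnitor₂ (tensor₁ M N)).hom =
      tensor₁Map (leftUnitor₂ M).hom (leftUnitor₂ N).hom := by
  refine hom_ext₁ fun x y => ?_
  simp only [lin_comp, LinearMap.comp_apply]
  rw [tensor₁Map_tens₁, leftUnitor₂_apply, leftUnitor₂_apply, leftUnitor₂_apply,
    linIncl₂_tensor₂Map, linIncl₂_interchange]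
  have key (u : A ⊗[k] M) (w : A ⊗[k] N) : lid k (tensor₁ M N)
      ((counit (R := k) (A := A)).rTensor (tensor₁ M N)
        (map₂ (LinearMap.mul k A) (tens₁ M N) u w)) =
      tens₁ M N (lid k M ((counit (R := k) (A := A)).rTensor M u))
        (lid k N ((counit (R := k) (A := A)).rTensor N w)) := by
    induction u, w using ind₂ with
    | addl _ _ _ h h' | addr _ _ _ h h' => simp only [map_add, LinearMap.add_apply, h, h']
    | tmul m a n b => simp [smul_smul, mul_comm]
  refine Eq.trans (congrArg (fun z => lid k (tensor₁ M N)
    ((counit (R := k) (A := A)).rTensor (tensor₁ M N) z)) ?_) (key _ _)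
  exact map_map₂ _ _ _ _ _ _

variable (k A) in
/-- The 2-fold monoidal structure on tetramodules. -/
def twoFoldMonoidal :
    TwoFoldMonoidalStructure (tautological k A) (tensorFunctor₁ k A) (tensorFunctor₂ k A) where
  first := monoidal₁ k A
  second := monoidal₂ k A
  η := interchange
  η_naturality := interchange_naturality
  internal_assoc := interchange_internal_assoc
  external_assoc := interchange_external_assoc
  internal_unit_right := interchange_internal_unit_right
  internal_unit_left := interchange_internal_unit_left
  external_unit_right := interchange_external_unit_right
  external_unit_left := interchange_external_unit_left

theorem map₂_tens₁_eq (M N P Q : Tetramodule k A) (x : M ⊗[k] N) (y : P ⊗[k] Q) :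
    map₂ (tens₁ M P) (tens₁ N Q) x y = map (linProj₁ M P) (linProj₁ N Q)
      (TensorProduct.tensorTensorTensorComm k M N P Q (x ⊗ₜ[k] y)) := by
  induction x, y using ind₂ with
  | addl _ _ _ h h' | addr _ _ _ h h' =>
    simp only [map_add, LinearMap.add_apply, add_tmul, tmul_add, h, h']
  | tmul m n p q => rfl

end interchange_coherence

end Tetramodule

end

theorem theorem2p2 (k : Type u) (A : Type v) [Field k] [Ring A] [Bialgebra k A] :
    ∃ S : TwoFoldMonoidalStructure (Tetramodule.tautological k A)
        (Tetramodule.tensorFunctor₁ k A) (Tetramodule.tensorFunctor₂ k A),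
      -- the interchange map is induced by swapping the two middle factors
      (∀ (M N P Q : Tetramodule k A) (x : Tetramodule.tensor₂ M N) (y : Tetramodule.tensor₂ P Q),
        Tetramodule.linIncl₂ (Tetramodule.tensor₁ M P) (Tetramodule.tensor₁ N Q)
            (Tetramodule.lin (S.η M N P Q)
              (Tetramodule.linProj₁ (Tetramodule.tensor₂ M N) (Tetramodule.tensor₂ P Q)
                (x ⊗ₜ[k] y))) =
          TensorProduct.map (Tetramodule.linProj₁ M P) (Tetramodule.linProj₁ N Q)
            (TensorProduct.tensorTensorTensorComm k M N P Q
              (Tetramodule.linIncl₂ M N x ⊗ₜ[k] Tetramodule.linIncl₂ P Q y))) ∧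
      -- the associativity isomorphisms are induced by those of `⊗` over `k`
      (∀ (M N P : Tetramodule k A) (m : M) (n : N) (p : P),
        Tetramodule.lin (S.first.α M N P).hom
            (Tetramodule.linProj₁ (Tetramodule.tensor₁ M N) P
              (Tetramodule.linProj₁ M N (m ⊗ₜ[k] n) ⊗ₜ[k] p)) =
          Tetramodule.linProj₁ M (Tetramodule.tensor₁ N P)
            (m ⊗ₜ[k] Tetramodule.linProj₁ N P (n ⊗ₜ[k] p))) ∧
      (∀ (M N P : Tetramodule k A) (x : Tetramodule.tensor₂ (Tetramodule.tensor₂ M N) P),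
        (Tetramodule.linIncl₂ N P).lTensor M
            (Tetramodule.linIncl₂ M (Tetramodule.tensor₂ N P)
              (Tetramodule.lin (S.second.α M N P).hom x)) =
          TensorProduct.assoc k M N P
            ((Tetramodule.linIncl₂ M N).rTensor P
              (Tetramodule.linIncl₂ (Tetramodule.tensor₂ M N) P x))) ∧
      -- the unit isomorphisms of `⊗₁` are the actions
      (∀ (M : Tetramodule k A) (a : A) (m : M),
        Tetramodule.lin (S.first.lam M).hom
          (Tetramodule.linProj₁ (Tetramodule.tautological k A) M (a ⊗ₜ[k] m)) = M.actL a m) ∧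
      (∀ (M : Tetramodule k A) (m : M) (a : A),
        Tetramodule.lin (S.first.rho M).hom
          (Tetramodule.linProj₁ M (Tetramodule.tautological k A) (m ⊗ₜ[k] a)) = M.actR m a) ∧
      -- the inverses of the unit isomorphisms of `⊗₂` are the coactions
      (∀ (M : Tetramodule k A) (m : M),
        Tetramodule.linIncl₂ (Tetramodule.tautological k A) M
          (Tetramodule.lin (S.second.lam M).inv m) = M.coactL m) ∧
      (∀ (M : Tetramodule k A) (m : M),
        Tetramodule.linIncl₂ M (Tetramodule.tautological k A)
          (Tetramodule.lin (S.second.rho M).inv m) = M.coactR m) :=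
  ⟨Tetramodule.twoFoldMonoidal k A,
    fun M N P Q x y => (Tetramodule.linIncl₂_interchange M N P Q x y).trans
      (Tetramodule.map₂_tens₁_eq M N P Q _ _),
    fun M N P m n p => Tetramodule.assoc₁_tens₁ M N P m n p,
    fun M N P x => Tetramodule.linIncl₂_assoc₂ M N P x,
    fun M a m => Tetramodule.leftUnitor₁_tens₁ M a m,
    fun M m a => Tetramodule.rightUnitor₁_tens₁ M m a,
    fun M m => Tetramodule.linIncl₂_leftUnitor₂_inv M m,
    fun M m => Tetramodule.linIncl₂_rightUnitor₂_inv M m⟩
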